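/- Let $\{X_n, n\ge 1\}$ be a sequence of independent and identically distributed random variables with values in a countable alphabet whose letters are labelled $1,2,3,\dots$, and let $p_i=p(i)=P(X_1=i)$, $i\ge 1$ (some $p_i$ may be $0$). Assume that $\{p_i\}$ is nonuniform, i.e. it is not constant on its support $\{i: p_i>0\}$. Let $0<\delta<\frac12$, assume $E|\ln p(X_1)|^{2+\delta}<\infty$, and assume that there are an integer valued function $K(n)$ and a constant $C_0$ such that, for all $n\ge 1$, $$K(n)\le n^{\frac12-\delta},\qquad n^{\frac12+\delta}\ln n\sum_{i\ge K(n)}p_i\le C_0,\qquad -n^{\frac12+\delta}\sum_{i\ge K(n)}p_i\ln p_i\le C_0,$$ where $i$ ranges over the letters $i\ge 1$ and $0\ln 0=0$. Assume moreover that $\sum_{i=1}^\infty p_i^{1-\epsilon}<\infty$ for some $\epsilon\in(\frac12,1)$ (letters with $p_i=0$ contribute $0$). Let $H=-\sum_{i=1}^\infty p_i\ln p_i$ be Shannon's entropy and $\sigma^2=\mathrm{Var}(\ln p(X_1))$, $\sigma\ge 0$. For $n\ge 2$ let $\hat p_i=\frac1n\sum_{k=1}^n I_{\{X_k=i\}}$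 and $\hat H_n=-\sum_{i=1}^\infty\hat p_i\ln\hat p_i$; for $1\le j\le n$ let $\hat p_i^{(j)}=\frac1{n-1}\bigl(\sum_{k=1}^n I_{\{X_k=i\}}-I_{\{X_j=i\}}\bigr)$ and $\hat H_n^{(j)}=-\sum_{i=1}^\infty\hat p_i^{(j)}\ln\hat p_i^{(j)}$; and let $$\hat H_{JK}=n\hat H_n-(n-1)\,\frac{\sum_{j=1}^n\hat H_n^{(j)}}{n}$$ be the jackknife entropy estimator. Then there is a constant $C$, not depending on $n$, such that for all $n\ge 2$ $$\sup_{x\in\mathbb R}\left|P\left(\frac{\sqrt n}{\sigma}(\hat H_{JK}-H)\le x\right)-\Phi(x)\right|\le Cn^{-\frac{\delta}{2}}+Cn^{\frac14-\frac{\epsilon}{2}},$$ where $\Phi$ is the standard normal distribution function. -/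

import Mathlib

open MeasureTheory ProbabilityTheory

noncomputable section

/-- The alphabet, labelled by the positive integers, carries its discrete σ-algebra. -/
instance instMeasurableSpaceLetters : MeasurableSpace ℕ+ := ⊤

/-- Shannon's entropy `-∑ qᵢ ln qᵢ` (natural logarithm, `0 ln 0 = 0`) of `q = {qᵢ, i ≥ 1}`. -/
def shannonEntropy (q : ℕ+ → ℝ) : ℝ := -∑' i, q i * Real.log (q i)

/-- The distribution `{pᵢ, i ≥ 1}` is nonuniform: it does not assign one and the same
probability to all the letters in its support. -/
def IsNonuniform (p : ℕ+ → ℝ) : Prop := ∃ i j, p i ≠ 0 ∧ p j ≠ 0 ∧ p i ≠ p j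

/-- The indicator of the event that an observation `y` is the letter `i`. -/
def letterInd (y i : ℕ+) : ℝ := if y = i then 1 else 0

/-- The sample proportions of the first `n` observations `x 0, …, x (n - 1)`. -/
def sampleProp (n : ℕ) (x : ℕ → ℕ+) (i : ℕ+) : ℝ :=
  (1 / (n : ℝ)) * ∑ k ∈ Finset.range n, letterInd (x k) i

/-- The sample proportions of `x 0, …, x (n - 1)` with the observation `x j` deleted. -/
def looSampleProp (n : ℕ) (x : ℕ → ℕ+) (j : ℕ) (i : ℕ+) : ℝ :=
  (1 / ((n : ℝ) - 1)) * (∑ k ∈ Finset.range n, letterInd (x k) i - letterInd (x j) i)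

/-- The plug-in entropy estimator based on the first `n` observations. -/
def plugInEntropy (n : ℕ) (x : ℕ → ℕ+) : ℝ := shannonEntropy (sampleProp n x)

/-- The jackknife entropy estimator based on the first `n` observations (`n ≥ 2`). -/
def jackknifeEntropy (n : ℕ) (x : ℕ → ℕ+) : ℝ :=
  (n : ℝ) * plugInEntropy n x -
    ((n : ℝ) - 1) * ((∑ j ∈ Finset.range n, shannonEntropy (looSampleProp n x j)) / (n : ℝ))

/-- The tail sum `∑_{i ≥ k} f i` over the letters `i ≥ 1`. -/
def tailSum (k : ℤ) (f : ℕ+ → ℝ) : ℝ := ∑' i : {i : ℕ+ // k ≤ ((i : ℕ) : ℤ)}, f i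

end

/-! ### Gaussian smoothing: from characteristic functions to distribution functions. -/

section Smoothing

open Set Filter Complex
open scoped NNReal Topology

/-! Let `A` be the sample average of `-ln p(X_k)`. It is an i.i.d. mean with expectation `H` and
variance `σ²/n`, so a Berry–Esseen bound with `2 + δ` moments gives `√n (A - H)/σ` the error
`n^(-δ/2)`. It remains to show that the jackknife estimator is close to `A` in mean.

The gap between `A` and the plug-in entropy is the relative entropy of the sample proportions with
respect to `p`. It is nonnegative (`plugInEntropy_le`). Above, it is at most a chi-square-type sum
over the letters below `K(n)`, plus the sample average of `-ln p` over the remaining letters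
(`le_plugInEntropy_add`). In expectation these are at most `K(n)/n` and equal to the tail of `-∑ p
ln p`, respectively, so after multiplication by `√n` both are `O(n^(-δ))`. The jackknife correction
is a sum of Jensen gaps, each in `[0, 1/n]`, over the observed letters
(`jackknifeEntropy_sub_plugInEntropy_mem_Icc`). The expected number of observed letters is at most
`n^(1-ε) ∑ p^(1-ε)`, which after scaling contributes `O(n^(1/2-ε))`.

By Markov's inequality, a mean error of order `η²` costs only `O(η)` in the distribution function
(`abs_measureReal_le_sub_cdf_le_of_perturbation`). This is why the final exponents are halved to
`-δ/2` and `1/4 - ε/2`.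

The Berry–Esseen bound (`exists_abs_measureReal_Iic_sub_le`) is proved by smoothing both laws with a
Gaussian of variance `n^(-3/4)`. The smoothing error `n^(-1/4)` is affordable because `δ ≤ 1/2`. -/

lemma gaussianPDFReal_eq_integral_exp {v : ℝ≥0} (hv : v ≠ 0) (x u : ℝ) :
    (gaussianPDFReal x v u : ℂ) = ((√(2 * Real.pi * v))⁻¹ : ℝ) *
      ∫ t, cexp (-(t * x * I)) * cexp (t * u * I) ∂gaussianReal 0 v⁻¹ := by
  -- A Gaussian density of variance `v` is, up to normalisation, the characteristic function of the
  -- Gaussian of variance `v⁻¹`; this replaces Fourier inversion.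
  have h := charFun_gaussianReal (μ := 0) (v := v⁻¹) (u - x)
  rw [charFun_apply_real] at h
  have h2 : ∀ t : ℝ, cexp (-(t * x * I)) * cexp (t * u * I)
      = cexp (((u - x : ℝ) : ℂ) * t * I) := fun t => by
    rw [← Complex.exp_add]; congr 1; push_cast; ring
  simp_rw [h2, h, gaussianPDFReal]
  have hv' : (v : ℂ) ≠ 0 := by exact_mod_cast hv
  push_cast
  congr 2
  field_simp
  ring

lemma measureReal_conv_gaussianReal {ν : Measure ℝ} [IsProbabilityMeasure ν] {v : ℝ≥0}
    (hv : v ≠ 0) {s : Set ℝ} (hs : MeasurableSet s) :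
    (ν ∗ gaussianReal 0 v).real s = ∫ x, (∫ u in s, gaussianPDFReal x v u) ∂ν := by
  have h1 : (ν ∗ gaussianReal 0 v) s = ∫⁻ x, gaussianReal x v s ∂ν := by
    rw [Measure.conv, Measure.map_apply (by fun_prop) hs,
      Measure.prod_apply (hs.preimage (by fun_prop))]
    refine lintegral_congr fun x => ?_
    have : gaussianReal x v = (gaussianReal 0 v).map (x + ·) := by
      rw [gaussianReal_map_const_add, zero_add]
    rw [this, Measure.map_apply (by fun_prop) hs]
    rfl
  have hm : Measurable fun x : ℝ => gaussianReal x v s := by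
    have : Measurable fun x : ℝ => gaussianReal x v := by fun_prop
    exact (Measure.measurable_coe hs).comp this
  have h2 : ∀ x : ℝ, (gaussianReal x v s).toReal = ∫ u in s, gaussianPDFReal x v u := fun x => by
    rw [gaussianReal_apply_eq_integral _ hv, ENNReal.toReal_ofReal]
    exact integral_nonneg fun u => gaussianPDFReal_nonneg _ _ _
  simp_rw [Measure.real, h1, ← h2]
  rw [integral_toReal hm.aemeasurable (ae_of_all _ fun x => measure_lt_top _ _)]

/-- Inversion formula for the smoothed law: insert the Fourier form of the Gaussian density and
apply Fubini twice. The finite Gaussian weight and the bounded interval make every integrand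
integrable. -/
lemma measureReal_conv_gaussianReal_Ioc {ν : Measure ℝ} [IsProbabilityMeasure ν] {v : ℝ≥0}
    (hv : v ≠ 0) {a b : ℝ} (hab : a ≤ b) :
    ((ν ∗ gaussianReal 0 v).real (Ioc a b) : ℂ) = ((√(2 * Real.pi * v))⁻¹ : ℝ) *
      ∫ t, charFun ν (-t) * (∫ u in a..b, cexp (t * u * I)) ∂gaussianReal 0 v⁻¹ := by
  rw [measureReal_conv_gaussianReal hv measurableSet_Ioc, ← integral_complex_ofReal]
  simp_rw [← integral_complex_ofReal, gaussianPDFReal_eq_integral_exp hv, integral_const_mul]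
  congr 1
  have hint : ∀ x : ℝ, Integrable (Function.uncurry fun u t : ℝ =>
      cexp (-(t * x * I)) * cexp (t * u * I))
      ((volume.restrict (Ioc a b)).prod (gaussianReal 0 v⁻¹)) := fun x => by
    refine Integrable.of_bound (C := 1) (by fun_prop) (ae_of_all _ fun p => ?_)
    simp only [Function.uncurry, norm_mul, Complex.norm_exp]
    simp
  have hI : ∀ x : ℝ, ∫ u in Ioc a b, (∫ t, cexp (-(t * x * I)) * cexp (t * u * I)
      ∂gaussianReal 0 v⁻¹) = ∫ t : ℝ, cexp (-(t * x * I)) * (∫ u in a..b, cexp (t * u * I))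
      ∂gaussianReal 0 v⁻¹ := fun x => by
    rw [integral_integral_swap (hint x)]
    simp_rw [integral_const_mul, intervalIntegral.integral_of_le hab]
  simp_rw [hI]
  rw [integral_integral_swap]
  · congr 1 with t
    rw [integral_mul_const, charFun_apply_real]
    congr 2 with x
    congr 1; push_cast; ring
  · refine Integrable.of_bound (C := b - a) ?_ (ae_of_all _ fun p => ?_)
    · refine AEStronglyMeasurable.mul (by fun_prop) ?_
      have : StronglyMeasurable fun t : ℝ => ∫ u in a..b, cexp (t * u * I) := by
        simp_rw [intervalIntegral.integral_of_le hab]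
        refine StronglyMeasurable.integral_prod_right (f := fun t u : ℝ => cexp (t * u * I)) ?_
        exact Continuous.stronglyMeasurable (by fun_prop)
      exact (this.comp_measurable measurable_snd).aestronglyMeasurable
    · simp only [Function.uncurry, norm_mul]
      have h1 : ‖cexp (-(p.2 * p.1 * I))‖ = 1 := by rw [Complex.norm_exp]; simp
      rw [h1, one_mul]
      have := intervalIntegral.norm_integral_le_of_norm_le_const (a := a) (b := b) (C := 1)
        (f := fun u : ℝ => cexp (p.2 * u * I)) fun u _ => by rw [Complex.norm_exp]; simp
      rwa [abs_of_nonneg (by linarith), one_mul] at this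

lemma norm_integral_exp_mul_I_le (a b : ℝ) {t : ℝ} (ht : t ≠ 0) :
    ‖∫ u in a..b, cexp (t * u * I)‖ ≤ 2 / |t| := by
  have hc : (t * I : ℂ) ≠ 0 := by simp [ht]
  have h := integral_exp_mul_complex (a := a) (b := b) hc
  have h2 : ∀ u : ℝ, cexp (t * u * I) = cexp (t * I * u) := fun u => by congr 1; ring
  simp_rw [h2, h, norm_div]
  have h3 : ‖(t * I : ℂ)‖ = |t| := by simp
  rw [h3]
  gcongr
  refine (norm_sub_le _ _).trans ?_
  simp only [Complex.norm_exp]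
  simp
  norm_num

/-- Comparison of two laws after Gaussian smoothing, in terms of characteristic functions. -/
lemma abs_conv_gaussianReal_Iic_sub_le {ν ρ : Measure ℝ} [IsProbabilityMeasure ν]
    [IsProbabilityMeasure ρ] {v : ℝ≥0} (hv : v ≠ 0) {g : ℝ → ℝ}
    (hg : Integrable g (gaussianReal 0 v⁻¹))
    (hle : ∀ t, t ≠ 0 → 2 / |t| * ‖charFun ν t - charFun ρ t‖ ≤ g (-t)) (b : ℝ) :
    |(ν ∗ gaussianReal 0 v).real (Iic b) - (ρ ∗ gaussianReal 0 v).real (Iic b)| ≤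
      (√(2 * Real.pi * v))⁻¹ * ∫ t, g t ∂gaussianReal 0 v⁻¹ := by
  -- The Fourier integral over `(a, b]` is at most `2/|t|` whatever `a` is, so the bound survives `a
  -- → -∞`.
  have key : ∀ a ≤ b, |(ν ∗ gaussianReal 0 v).real (Ioc a b)
      - (ρ ∗ gaussianReal 0 v).real (Ioc a b)| ≤
      (√(2 * Real.pi * v))⁻¹ * ∫ t, g t ∂gaussianReal 0 v⁻¹ := fun a hab => by
    have hi : ∀ (κ : Measure ℝ) [IsProbabilityMeasure κ], Integrable (fun t : ℝ =>
        charFun κ (-t) * ∫ u in a..b, cexp (t * u * I)) (gaussianReal 0 v⁻¹) := fun κ _ => by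
      refine Integrable.of_bound (C := b - a) ?_ (ae_of_all _ fun t => ?_)
      · refine AEStronglyMeasurable.mul ?_ ?_
        · exact (measurable_charFun.comp measurable_neg).aestronglyMeasurable
        · have : StronglyMeasurable fun t : ℝ => ∫ u in a..b, cexp (t * u * I) := by
            simp_rw [intervalIntegral.integral_of_le hab]
            refine StronglyMeasurable.integral_prod_right (f := fun t u : ℝ => cexp (t * u * I)) ?_
            exact Continuous.stronglyMeasurable (by fun_prop)
          exact this.aestronglyMeasurable
      · rw [norm_mul]
        have := intervalIntegral.norm_integral_le_of_norm_le_const (a := a) (b := b) (C := 1)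
          (f := fun u : ℝ => cexp (t * u * I)) fun u _ => by rw [Complex.norm_exp]; simp
        rw [abs_of_nonneg (by linarith), one_mul] at this
        calc _ ≤ 1 * (b - a) := by
              gcongr
              exact norm_charFun_le_one _
          _ = b - a := one_mul _
    have e : ((((ν ∗ gaussianReal 0 v).real (Ioc a b)
      - (ρ ∗ gaussianReal 0 v).real (Ioc a b) : ℝ)) : ℂ) = ((√(2 * Real.pi * v))⁻¹ : ℝ) *
        ∫ t, (charFun ν (-t) - charFun ρ (-t)) * (∫ u in a..b, cexp (t * u * I))
          ∂gaussianReal 0 v⁻¹ := by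
      push_cast
      rw [measureReal_conv_gaussianReal_Ioc hv hab, measureReal_conv_gaussianReal_Ioc hv hab,
        ← mul_sub, ← integral_sub (hi ν) (hi ρ)]
      simp_rw [sub_mul]
      push_cast
      rfl
    rw [← Real.norm_eq_abs, ← Complex.norm_real, e, norm_mul, Complex.norm_real, Real.norm_eq_abs,
      abs_of_nonneg (by positivity)]
    gcongr
    refine norm_integral_le_of_norm_le hg ?_
    have hne : ∀ᵐ t ∂gaussianReal 0 v⁻¹, t ≠ 0 := by
      have : ∀ᵐ t : ℝ, t ≠ 0 := by
        simp [ae_iff]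
      exact (gaussianReal_absolutelyContinuous 0 (inv_ne_zero hv)).ae_le this
    filter_upwards [hne] with t ht
    rw [norm_mul, mul_comm]
    have h1 := hle (-t) (neg_ne_zero.2 ht)
    rw [neg_neg, abs_neg] at h1
    refine le_trans ?_ h1
    gcongr
    exact norm_integral_exp_mul_I_le a b ht
  have hlim : ∀ (κ : Measure ℝ) [IsProbabilityMeasure κ],
      Tendsto (fun a => κ.real (Ioc a b)) atBot (𝓝 (κ.real (Iic b))) := fun κ _ => by
    exact (ENNReal.tendsto_toReal (measure_ne_top _ _)).comp (tendsto_measure_Ioc_atBot κ b)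
  have := ((hlim (ν ∗ gaussianReal 0 v)).sub (hlim (ρ ∗ gaussianReal 0 v))).abs
  exact le_of_tendsto this ((eventually_le_atBot b).mono key)

/-- Chebyshev's inequality suffices, since the target rate is never better than `n^(-1/4)`. -/
lemma gaussianReal_abs_ge_le {v : ℝ≥0} {a : ℝ} (ha : 0 < a) :
    (gaussianReal 0 v).real {y | a ≤ |y|} ≤ v / a ^ 2 := by
  have h := meas_ge_le_variance_div_sq (μ := gaussianReal 0 v) (X := id)
    (memLp_id_gaussianReal 2) ha
  simp only [variance_id_gaussianReal, id_eq, integral_id_gaussianReal, sub_zero] at h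
  have h2 := ENNReal.toReal_mono (by simp) h
  rwa [ENNReal.toReal_ofReal (by positivity)] at h2

/-- Unless the Gaussian noise reaches size `a`, adding it moves a point by less than `a`. -/
lemma measureReal_Iic_le_conv {ν γ : Measure ℝ} [IsProbabilityMeasure ν] [IsProbabilityMeasure γ]
    (x a : ℝ) : ν.real (Iic x) ≤ (ν ∗ γ).real (Iic (x + a)) + γ.real {y | a ≤ |y|} := by
  have hm : MeasurableSet {y : ℝ | a ≤ |y|} := measurableSet_le (by fun_prop) (by fun_prop)
  have h1 : ν.real (Iic x) = (ν.prod γ).real (Prod.fst ⁻¹' Iic x) := by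
    rw [← map_measureReal_apply measurable_fst measurableSet_Iic]; simp [Measure.map_fst_prod]
  have h2 : γ.real {y | a ≤ |y|} = (ν.prod γ).real (Prod.snd ⁻¹' {y | a ≤ |y|}) := by
    rw [← map_measureReal_apply measurable_snd hm]; simp [Measure.map_snd_prod]
  rw [h1, h2, Measure.conv, map_measureReal_apply (by fun_prop) measurableSet_Iic]
  refine le_trans (measureReal_mono ?_) (measureReal_union_le _ _)
  rintro ⟨y, z⟩ hy
  simp only [mem_preimage, mem_Iic, mem_union] at hy ⊢
  by_cases h : a ≤ |z|
  · exact Or.inr h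
  · left; push Not at h; linarith [le_abs_self z]

lemma conv_le_measureReal_Iic {ν γ : Measure ℝ} [IsProbabilityMeasure ν] [IsProbabilityMeasure γ]
    (x a : ℝ) : (ν ∗ γ).real (Iic (x - a)) ≤ ν.real (Iic x) + γ.real {y | a ≤ |y|} := by
  have hm : MeasurableSet {y : ℝ | a ≤ |y|} := measurableSet_le (by fun_prop) (by fun_prop)
  have h1 : ν.real (Iic x) = (ν.prod γ).real (Prod.fst ⁻¹' Iic x) := by
    rw [← map_measureReal_apply measurable_fst measurableSet_Iic]; simp [Measure.map_fst_prod]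
  have h2 : γ.real {y | a ≤ |y|} = (ν.prod γ).real (Prod.snd ⁻¹' {y | a ≤ |y|}) := by
    rw [← map_measureReal_apply measurable_snd hm]; simp [Measure.map_snd_prod]
  rw [h1, h2, Measure.conv, map_measureReal_apply (by fun_prop) measurableSet_Iic]
  refine le_trans (measureReal_mono ?_) (measureReal_union_le _ _)
  rintro ⟨y, z⟩ hy
  simp only [mem_preimage, mem_Iic, mem_union] at hy ⊢
  by_cases h : a ≤ |z|
  · exact Or.inr h
  · left; push Not at h; linarith [neg_abs_le z]

/-- The standard normal distribution function is 1-Lipschitz. -/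
lemma gaussianReal_Iic_add_le (x : ℝ) {d : ℝ} (hd : 0 ≤ d) :
    (gaussianReal 0 1).real (Iic (x + d)) ≤ (gaussianReal 0 1).real (Iic x) + d := by
  have hsub : Iic (x + d) ⊆ Iic x ∪ Ioc x (x + d) := fun y hy => by
    simp only [mem_union, mem_Iic, mem_Ioc] at *
    by_cases h : y ≤ x
    · exact Or.inl h
    · exact Or.inr ⟨not_le.1 h, hy⟩
  refine (measureReal_mono hsub).trans ((measureReal_union_le _ _).trans ?_)
  gcongr
  rw [Measure.real, gaussianReal_apply_eq_integral 0 one_ne_zero, ENNReal.toReal_ofReal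
    (integral_nonneg fun u => gaussianPDFReal_nonneg _ _ _)]
  calc ∫ u in Ioc x (x + d), gaussianPDFReal 0 1 u ≤ ∫ u in Ioc x (x + d), (1 : ℝ) := by
        refine setIntegral_mono (integrable_gaussianPDFReal _ _).integrableOn (by simp) fun u => ?_
        rw [gaussianPDFReal]
        have h1 : (√(2 * Real.pi * (1 : ℝ≥0)))⁻¹ ≤ 1 := by
          refine inv_le_one_of_one_le₀ ?_
          rw [Real.one_le_sqrt]
          have := Real.pi_gt_three
          push_cast; linarith
        have h2 : Real.exp (-(u - 0) ^ 2 / (2 * (1 : ℝ≥0))) ≤ 1 := by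
          rw [Real.exp_le_one_iff]
          have := sq_nonneg (u - 0)
          push_cast; linarith
        calc _ ≤ (1 : ℝ) * 1 := by gcongr
          _ = 1 := one_mul _
    _ = d := by simp [hd]

/-- A smoothing inequality. -/
lemma abs_measureReal_Iic_sub_gaussianReal_le {ν : Measure ℝ} [IsProbabilityMeasure ν]
    {v : ℝ≥0} {a B : ℝ} (ha : 0 < a)
    (hB : ∀ b, |(ν ∗ gaussianReal 0 v).real (Iic b)
      - (gaussianReal 0 1 ∗ gaussianReal 0 v).real (Iic b)| ≤ B) (x : ℝ) :
    |ν.real (Iic x) - (gaussianReal 0 1).real (Iic x)| ≤ B + 2 * (v / a ^ 2) + 2 * a := by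
  have hv := gaussianReal_abs_ge_le (v := v) ha
  rw [abs_sub_le_iff]
  constructor
  · have h1 := measureReal_Iic_le_conv (ν := ν) (γ := gaussianReal 0 v) x a
    have h2 := (abs_le.1 (hB (x + a))).2
    have h3 := conv_le_measureReal_Iic (ν := gaussianReal 0 1) (γ := gaussianReal 0 v) (x + 2 * a) a
    rw [show x + 2 * a - a = x + a by ring] at h3
    have h4 := gaussianReal_Iic_add_le x (d := 2 * a) (by positivity)
    linarith
  · have h1 := conv_le_measureReal_Iic (ν := ν) (γ := gaussianReal 0 v) x a
    have h2 := (abs_le.1 (hB (x - a))).1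
    have h3 := measureReal_Iic_le_conv (ν := gaussianReal 0 1) (γ := gaussianReal 0 v) (x - 2 * a) a
    rw [show x - 2 * a + a = x - a by ring] at h3
    have h4 := gaussianReal_Iic_add_le (x - 2 * a) (d := 2 * a) (by positivity)
    rw [sub_add_cancel] at h4
    linarith

end Smoothing

/-! ### Rate of convergence of the characteristic functions of normalised sums. -/

section CharFunRate

open Set Filter Complex
open scoped NNReal Topology

/-- For `|y| ≤ 1` the cubic remainder is at most a multiple of `|y|^(2+δ)` because `δ ≤ 1`; for `|y|
> 1` every term is dominated by `y²`, hence by `|y|^(2+δ)`. -/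
lemma norm_exp_mul_I_sub_taylor_two_le {δ : ℝ} (hδ0 : 0 < δ) (hδ : δ ≤ 1) (y : ℝ) :
    ‖cexp (y * I) - (1 + y * I - y ^ 2 / 2)‖ ≤ 4 * |y| ^ (2 + δ) := by
  rcases le_or_gt |y| 1 with h | h
  · have hb := Complex.exp_bound (x := y * I) (by simpa using h) (n := 3) (by norm_num)
    have e : ∑ m ∈ Finset.range 3, (y * I : ℂ) ^ m / (m.factorial : ℂ)
        = 1 + y * I - y ^ 2 / 2 := by
      simp only [Finset.sum_range_succ, Finset.sum_range_zero, Nat.factorial]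
      push_cast
      linear_combination (y ^ 2 / 2 : ℂ) * I_sq
    rw [e] at hb
    refine hb.trans ?_
    have h3 : |y| ^ 3 ≤ |y| ^ (2 + δ) := by
      rcases eq_or_ne y 0 with rfl | hy
      · simp; positivity
      rw [← Real.rpow_natCast]
      exact Real.rpow_le_rpow_of_exponent_ge (abs_pos.2 hy) h (by norm_num; linarith)
    have h0 : 0 ≤ |y| ^ (2 + δ) := by positivity
    have h5 : ‖(y * I : ℂ)‖ = |y| := by simp
    rw [h5]
    norm_num [Nat.factorial]
    have h6 : 0 ≤ |y| ^ 3 := by positivity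
    linarith
  · have h2 : y ^ 2 ≤ |y| ^ (2 + δ) := by
      rw [← sq_abs, ← Real.rpow_natCast]
      exact Real.rpow_le_rpow_of_exponent_le h.le (by norm_num; linarith)
    have h3 : |y| ≤ y ^ 2 := by rw [← sq_abs]; nlinarith
    have h4 : ‖cexp (y * I)‖ = 1 := by rw [Complex.norm_exp]; simp
    have h5 : ‖(1 + y * I - y ^ 2 / 2 : ℂ)‖ ≤ 1 + |y| + y ^ 2 / 2 := by
      refine (norm_sub_le _ _).trans (add_le_add ((norm_add_le _ _).trans ?_) ?_)
      · simp
      · simp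
    refine (norm_sub_le _ _).trans ?_
    rw [h4]
    linarith

variable {ν : Measure ℝ} [IsProbabilityMeasure ν] {δ : ℝ}

lemma norm_charFun_sub_taylor_two_le (hδ0 : 0 < δ) (hδ : δ ≤ 1)
    (hint : Integrable (fun x => |x| ^ (2 + δ)) ν) (hi1 : Integrable (fun x => x) ν)
    (hi2 : Integrable (fun x => x ^ 2) ν) (h1 : ∫ x, x ∂ν = 0) (h2 : ∫ x, x ^ 2 ∂ν = 1) (s : ℝ) :
    ‖charFun ν s - (1 - s ^ 2 / 2)‖ ≤ 4 * (∫ x, |x| ^ (2 + δ) ∂ν) * |s| ^ (2 + δ) := by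
  have e1 : Integrable (fun x : ℝ => ((s * x : ℝ) : ℂ) * I) ν :=
    ((hi1.const_mul s).ofReal).mul_const I
  have e2 : Integrable (fun x : ℝ => ((s * x : ℝ) : ℂ) ^ 2 / 2) ν := by
    refine ((hi2.const_mul (s ^ 2 / 2)).ofReal (𝕜 := ℂ)).congr (ae_of_all _ fun x => ?_)
    have : ((s ^ 2 / 2 * x ^ 2 : ℝ) : ℂ) = ((s * x : ℝ) : ℂ) ^ 2 / 2 := by push_cast; ring
    exact this
  have e3 : Integrable (fun x : ℝ => (1 : ℂ) + ((s * x : ℝ) : ℂ) * I) ν :=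
    (integrable_const _).add e1
  have e4 : Integrable (fun x : ℝ => (1 : ℂ) + ((s * x : ℝ) : ℂ) * I -
      ((s * x : ℝ) : ℂ) ^ 2 / 2) ν := e3.sub e2
  have e0 : Integrable (fun x : ℝ => cexp (((s * x : ℝ) : ℂ) * I)) ν := by
    refine Integrable.of_bound (C := 1) (by fun_prop) (ae_of_all _ fun p => ?_)
    rw [Complex.norm_exp]; simp
  have key : charFun ν s - (1 - s ^ 2 / 2) = ∫ x : ℝ, (cexp (((s * x : ℝ) : ℂ) * I) -
      (1 + ((s * x : ℝ) : ℂ) * I - ((s * x : ℝ) : ℂ) ^ 2 / 2)) ∂ν := by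
    have i1 : ∫ x : ℝ, ((s * x : ℝ) : ℂ) * I ∂ν = 0 := by
      rw [integral_mul_const, integral_complex_ofReal, integral_const_mul, h1]; simp
    have i2 : ∫ x : ℝ, (((s * x : ℝ) : ℂ) ^ 2 / 2 : ℂ) ∂ν = (s : ℂ) ^ 2 / 2 := by
      have : ∀ x : ℝ, ((s * x : ℝ) : ℂ) ^ 2 / 2 = ((s ^ 2 / 2 * x ^ 2 : ℝ) : ℂ) := fun x => by
        push_cast; ring
      simp_rw [this]
      rw [integral_complex_ofReal, integral_const_mul, h2]; push_cast; ring
    rw [integral_sub e0 e4, integral_sub e3 e2, integral_add (integrable_const _) e1, i1, i2,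
      charFun_apply_real]
    simp
  rw [key]
  refine (norm_integral_le_of_norm_le (hint.const_mul (4 * |s| ^ (2 + δ)))
    (ae_of_all _ fun x => ?_)).trans_eq ?_
  · refine (norm_exp_mul_I_sub_taylor_two_le hδ0 hδ (s * x)).trans_eq ?_
    rw [abs_mul, Real.mul_rpow (abs_nonneg _) (abs_nonneg _)]; ring
  · rw [integral_const_mul]; ring

lemma norm_pow_sub_pow_le_mul {a b : ℂ} {M : ℝ} (ha : ‖a‖ ≤ M) (hb : ‖b‖ ≤ M) (n : ℕ) :
    ‖a ^ n - b ^ n‖ ≤ n * ‖a - b‖ * M ^ (n - 1) := by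
  rw [← (Commute.all a b).mul_geom_sum₂, norm_mul]
  have hM : 0 ≤ M := (norm_nonneg _).trans ha
  have : ‖∑ i ∈ Finset.range n, a ^ i * b ^ (n - 1 - i)‖ ≤ n * M ^ (n - 1) := by
    refine (norm_sum_le _ _).trans ?_
    have h : ∀ i ∈ Finset.range n, ‖a ^ i * b ^ (n - 1 - i)‖ ≤ M ^ (n - 1) := fun i hi => by
      rw [norm_mul, norm_pow, norm_pow]
      have hi := Finset.mem_range.1 hi
      calc _ ≤ M ^ i * M ^ (n - 1 - i) := by gcongr
        _ = M ^ (n - 1) := by rw [← pow_add]; congr 1; omega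
    simpa using Finset.sum_le_sum h
  calc _ ≤ ‖a - b‖ * (n * M ^ (n - 1)) := by gcongr
    _ = _ := by ring

lemma exists_norm_charFun_pow_sub_le (hδ0 : 0 < δ) (hδ : δ ≤ 1)
    (hint : Integrable (fun x => |x| ^ (2 + δ)) ν) (hi1 : Integrable (fun x => x) ν)
    (hi2 : Integrable (fun x => x ^ 2) ν) (h1 : ∫ x, x ∂ν = 0) (h2 : ∫ x, x ^ 2 ∂ν = 1) :
    ∃ A c : ℝ, 0 ≤ A ∧ 0 < c ∧ ∀ n : ℕ, 2 ≤ n → ∀ t : ℝ, |t| ≤ c * √n →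
      ‖charFun ν ((√n)⁻¹ * t) ^ n - cexp (-t ^ 2 / 2)‖ ≤
        A * (n : ℝ) ^ (-δ / 2) * |t| ^ (2 + δ) * Real.exp (-t ^ 2 / 8) := by
  set β := ∫ x, |x| ^ (2 + δ) ∂ν
  have hβ : 0 ≤ β := integral_nonneg fun x => by positivity
  -- For `|s| ≤ c` the Taylor remainder is then at most `s²/4`, half of the quadratic term, so
  -- `|φ(s)| ≤ 1 - s²/4 ≤ exp(-s²/4)`.
  obtain ⟨c, hc0, hc1, hcβ⟩ : ∃ c : ℝ, 0 < c ∧ c ≤ 1 ∧ 4 * β * c ^ δ ≤ 1 / 4 := by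
    refine ⟨(1 + 16 * β) ^ (-1 / δ), by positivity, ?_, ?_⟩
    · exact Real.rpow_le_one_of_one_le_of_nonpos (by linarith)
        (div_nonpos_of_nonpos_of_nonneg (by norm_num) hδ0.le)
    · rw [← Real.rpow_mul (by positivity), div_mul_cancel₀ _ hδ0.ne', Real.rpow_neg_one]
      have : 0 < 1 + 16 * β := by positivity
      rw [← div_eq_mul_inv, div_le_iff₀ this]; linarith
  refine ⟨4 * β + 1, c, by positivity, hc0, fun n hn t ht => ?_⟩
  have hn0 : (0 : ℝ) < n := by positivity
  have hsn : 0 < √(n : ℝ) := Real.sqrt_pos.2 hn0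
  set s := (√(n : ℝ))⁻¹ * t with hs
  have hsc : |s| ≤ c := by
    rw [hs, abs_mul, abs_of_pos (by positivity), inv_mul_le_iff₀ hsn]; linarith
  have hsq : s ^ 2 = t ^ 2 / n := by
    rw [hs, mul_pow, inv_pow, Real.sq_sqrt hn0.le]; ring
  have hpow : |s| ^ (2 + δ) = s ^ 2 * |s| ^ δ := by
    rw [Real.rpow_add_of_nonneg (abs_nonneg _) (by norm_num) hδ0.le]; norm_num
  have hsδ : |s| ^ δ ≤ c ^ δ := by gcongr
  have hT := norm_charFun_sub_taylor_two_le hδ0 hδ hint hi1 hi2 h1 h2 s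
  have hs1 : s ^ 2 ≤ 1 := by rw [← sq_abs]; nlinarith [abs_nonneg s]
  have hφ : ‖charFun ν s‖ ≤ Real.exp (-s ^ 2 / 4) := by
    have hr : ‖(1 - s ^ 2 / 2 : ℂ)‖ = 1 - s ^ 2 / 2 := by
      rw [show (1 - s ^ 2 / 2 : ℂ) = ((1 - s ^ 2 / 2 : ℝ) : ℂ) by push_cast; rfl, Complex.norm_real,
        Real.norm_of_nonneg (by linarith)]
    have h3 : ‖charFun ν s‖ ≤ (1 - s ^ 2 / 2) + 4 * β * |s| ^ (2 + δ) := by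
      rw [← hr]
      have := norm_le_norm_add_norm_sub' (charFun ν s) (1 - s ^ 2 / 2 : ℂ)
      linarith
    have h4 : 4 * β * |s| ^ (2 + δ) ≤ s ^ 2 * (1 / 4) := by
      rw [hpow]
      calc 4 * β * (s ^ 2 * |s| ^ δ) ≤ 4 * β * (s ^ 2 * c ^ δ) := by gcongr
        _ = s ^ 2 * (4 * β * c ^ δ) := by ring
        _ ≤ _ := by gcongr
    have := Real.add_one_le_exp (-s ^ 2 / 4)
    linarith
  have hψ : ‖cexp (-s ^ 2 / 2)‖ ≤ Real.exp (-s ^ 2 / 4) := by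
    rw [show (-s ^ 2 / 2 : ℂ) = ((-s ^ 2 / 2 : ℝ) : ℂ) by push_cast; rfl, ← Complex.ofReal_exp,
      Complex.norm_real, Real.norm_of_nonneg (Real.exp_pos _).le, Real.exp_le_exp]
    nlinarith [sq_nonneg s]
  have hdiff : ‖charFun ν s - cexp (-s ^ 2 / 2)‖ ≤ (4 * β + 1) * |s| ^ (2 + δ) := by
    have h5 : ‖cexp (-s ^ 2 / 2) - (1 - s ^ 2 / 2)‖ ≤ |s| ^ (2 + δ) := by
      have := Real.norm_exp_sub_one_sub_id_le (x := -s ^ 2 / 2) (by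
        rw [Real.norm_eq_abs, abs_of_nonpos (by nlinarith [sq_nonneg s])]; linarith)
      have e : cexp (-s ^ 2 / 2) - (1 - s ^ 2 / 2) =
          ((Real.exp (-s ^ 2 / 2) - 1 - (-s ^ 2 / 2) : ℝ) : ℂ) := by push_cast; ring
      rw [e, Complex.norm_real]
      refine this.trans ?_
      rw [Real.norm_eq_abs, sq_abs]
      have h6 : |s| ^ 4 ≤ |s| ^ (2 + δ) := by
        rcases eq_or_ne s 0 with h0 | hs0
        · rw [h0]; simp; positivity
        rw [← Real.rpow_natCast]
        exact Real.rpow_le_rpow_of_exponent_ge (abs_pos.2 hs0) (hsc.trans hc1)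
          (by norm_num; linarith)
      have h7 : |s| ^ 4 = s ^ 4 := by rw [show 4 = 2 * 2 by rfl, pow_mul, sq_abs, ← pow_mul]
      nlinarith [sq_nonneg (s ^ 2)]
    have := norm_sub_le_norm_sub_add_norm_sub (charFun ν s) (1 - s ^ 2 / 2 : ℂ) (cexp (-s ^ 2 / 2))
    rw [norm_sub_rev (1 - s ^ 2 / 2 : ℂ)] at this
    linarith
  have hmain := norm_pow_sub_pow_le_mul hφ hψ n
  have epow : cexp (-s ^ 2 / 2) ^ n = cexp (-t ^ 2 / 2) := by
    rw [← Complex.exp_nat_mul]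
    congr 1
    have : (n : ℂ) ≠ 0 := by exact_mod_cast hn0.ne'
    have hq : (s : ℂ) ^ 2 = (t : ℂ) ^ 2 / n := by exact_mod_cast hsq
    rw [hq]; field_simp
  -- One factor is lost to the telescoping of `aⁿ - bⁿ`; `(n-1)/n ≥ 1/2` turns the exponent `t²/4`
  -- into `t²/8`.
  have eexp : Real.exp (-s ^ 2 / 4) ^ (n - 1) ≤ Real.exp (-t ^ 2 / 8) := by
    rw [← Real.exp_nat_mul, Real.exp_le_exp, hsq, Nat.cast_sub (by omega)]
    have h2n : (2 : ℝ) ≤ n := by exact_mod_cast hn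
    push_cast
    rw [show ((n : ℝ) - 1) * (-(t ^ 2 / n) / 4) = -((t ^ 2 / 4) * ((n - 1) / n)) by ring]
    have : (1 / 2 : ℝ) ≤ (n - 1) / n := by rw [le_div_iff₀ hn0]; linarith
    nlinarith [sq_nonneg t]
  have espow : (n : ℝ) * |s| ^ (2 + δ) = (n : ℝ) ^ (-δ / 2) * |t| ^ (2 + δ) := by
    rw [hs, abs_mul, abs_of_pos (by positivity : 0 < (√(n : ℝ))⁻¹),
      Real.mul_rpow (by positivity) (abs_nonneg _), ← mul_assoc]
    congr 1
    rw [Real.sqrt_eq_rpow, ← Real.rpow_neg hn0.le, ← Real.rpow_mul hn0.le]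
    nth_rw 1 [← Real.rpow_one (n : ℝ)]
    rw [← Real.rpow_add hn0]; congr 1; ring
  rw [epow] at hmain
  calc _ ≤ _ := hmain
    _ ≤ n * ((4 * β + 1) * |s| ^ (2 + δ)) * Real.exp (-t ^ 2 / 8) := by gcongr
    _ = (4 * β + 1) * (n * |s| ^ (2 + δ)) * Real.exp (-t ^ 2 / 8) := by ring
    _ = _ := by rw [espow]; ring

end CharFunRate

/-! ### Berry–Esseen bound from characteristic functions. -/

section BerryEsseen

open Set Filter Complex
open scoped NNReal Topology

variable {ν : Measure ℝ} [IsProbabilityMeasure ν] {δ : ℝ}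

lemma integrable_one_add_sq_mul_exp : Integrable fun t : ℝ => (1 + t ^ 2) * Real.exp (-t ^ 2 / 8) := by
  have h0 := integrable_exp_neg_mul_sq (b := 1 / 8) (by norm_num)
  have h2 := integrable_rpow_mul_exp_neg_mul_sq (b := 1 / 8) (by norm_num) (s := 2) (by norm_num)
  refine (h0.add h2).congr (ae_of_all _ fun t => ?_)
  simp only [Pi.add_apply, Real.rpow_two]
  rw [show -t ^ 2 / 8 = -(1 / 8) * t ^ 2 by ring]; ring

/-- The prefactor times the Gaussian normalisation is `1/(2π)`, so the weight against Lebesgue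
measure is at most `1`, uniformly in `v`. -/
lemma integral_gaussianReal_le_integral {f : ℝ → ℝ} (hf : Integrable f) (hf0 : ∀ t, 0 ≤ f t)
    {v : ℝ≥0} (hv : v ≠ 0) :
    (√(2 * Real.pi * v))⁻¹ * ∫ t, f t ∂gaussianReal 0 v⁻¹ ≤ ∫ t, f t := by
  rw [integral_gaussianReal_eq_integral_smul (inv_ne_zero hv), ← integral_const_mul]
  have hv' : (0 : ℝ) < v := by positivity
  refine integral_mono_of_nonneg (ae_of_all _ fun t => ?_) hf (ae_of_all _ fun t => ?_)
  · have := gaussianPDFReal_nonneg 0 v⁻¹ t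
    have := hf0 t
    simp only [smul_eq_mul, Pi.zero_apply]
    positivity
  · simp only [smul_eq_mul, ← mul_assoc, gaussianPDFReal]
    have h1 : (√(2 * Real.pi * v))⁻¹ * (√(2 * Real.pi * (v⁻¹ : ℝ≥0)))⁻¹ ≤ 1 := by
      rw [← mul_inv, ← Real.sqrt_mul (by positivity)]
      refine inv_le_one_of_one_le₀ ?_
      rw [Real.one_le_sqrt]
      have e : 2 * Real.pi * v * (2 * Real.pi * (v⁻¹ : ℝ≥0)) = (2 * Real.pi) ^ 2 := by
        push_cast; field_simp
      rw [e]
      nlinarith [Real.pi_gt_three]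
    have h2 : Real.exp (-(t - 0) ^ 2 / (2 * (v⁻¹ : ℝ≥0))) ≤ 1 := by
      rw [Real.exp_le_one_iff]
      exact div_nonpos_of_nonpos_of_nonneg (by nlinarith [sq_nonneg (t - 0)]) (by positivity)
    calc _ ≤ (1 : ℝ) * 1 * f t := by
          gcongr
          exact hf0 t
      _ = f t := by ring

lemma integral_sq_gaussianReal_zero (v : ℝ≥0) : ∫ t, t ^ 2 ∂gaussianReal 0 v = v := by
  have h := variance_eq_sub (memLp_id_gaussianReal (μ := 0) (v := v) 2)
  simp only [variance_id_gaussianReal, id_eq, integral_id_gaussianReal] at h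
  simpa using h.symm

lemma integrable_sq_gaussianReal (v : ℝ≥0) : Integrable (fun t => t ^ 2) (gaussianReal 0 v) :=
  (memLp_id_gaussianReal (μ := 0) (v := v) 2).integrable_sq

/-- A Berry–Esseen theorem for laws with a finite absolute moment of order `2 + δ`, `δ ≤ 1 / 2`,
in terms of characteristic functions. -/
theorem exists_abs_measureReal_Iic_sub_le (hδ0 : 0 < δ) (hδ : δ ≤ 1 / 2)
    (hint : Integrable (fun x => |x| ^ (2 + δ)) ν) (hi1 : Integrable (fun x => x) ν)
    (hi2 : Integrable (fun x => x ^ 2) ν) (h1 : ∫ x, x ∂ν = 0) (h2 : ∫ x, x ^ 2 ∂ν = 1) :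
    ∃ C : ℝ, ∀ n : ℕ, 2 ≤ n → ∀ (ρ : Measure ℝ) [IsProbabilityMeasure ρ],
      (∀ t, charFun ρ t = charFun ν ((√n)⁻¹ * t) ^ n) → ∀ x,
      |ρ.real (Iic x) - (gaussianReal 0 1).real (Iic x)| ≤ C * (n : ℝ) ^ (-δ / 2) := by
  obtain ⟨A, c, hA, hc, hbound⟩ :=
    exists_norm_charFun_pow_sub_le hδ0 (by linarith) hint hi1 hi2 h1 h2
  set M := ∫ t : ℝ, (1 + t ^ 2) * Real.exp (-t ^ 2 / 8)
  refine ⟨2 * A * M + 4 / c ^ 3 + 4, fun n hn ρ _ hρ x => ?_⟩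
  have hn0 : (0 : ℝ) < n := by positivity
  have hn1 : (1 : ℝ) ≤ n := by exact_mod_cast (by omega : 1 ≤ n)
  have hsn : 0 < √(n : ℝ) := Real.sqrt_pos.2 hn0
  -- With this variance, noise of size `n^(-1/4)` has Chebyshev probability at most `n^(-1/4)`,
  -- while frequencies beyond `c√n` cost `n^(-3/2) v^(-3/2) = n^(-3/8)`; both are at most
  -- `n^(-δ/2)`.
  set v : ℝ≥0 := (n : ℝ≥0) ^ (-3 / 4 : ℝ) with hvdef
  have hv0 : v ≠ 0 := by rw [hvdef]; positivity
  have hvr : (v : ℝ) = (n : ℝ) ^ (-3 / 4 : ℝ) := by rw [hvdef]; simp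
  set T := c * √(n : ℝ) with hT
  have hT0 : 0 < T := by positivity
  set r := (n : ℝ) ^ (-δ / 2) with hr
  have hr0 : 0 < r := by positivity
  let g : ℝ → ℝ := fun t => 2 * A * r * ((1 + t ^ 2) * Real.exp (-t ^ 2 / 8)) + 4 / T ^ 3 * t ^ 2
  have hg1 : Integrable (fun t : ℝ => (1 + t ^ 2) * Real.exp (-t ^ 2 / 8))
      (gaussianReal 0 v⁻¹) := by
    refine ((integrable_const 1).add (integrable_sq_gaussianReal v⁻¹)).mono'
      (by fun_prop) (ae_of_all _ fun t => ?_)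
    rw [Real.norm_of_nonneg (by positivity)]
    have h2 : Real.exp (-t ^ 2 / 8) ≤ 1 := by
      rw [Real.exp_le_one_iff]; nlinarith [sq_nonneg t]
    calc _ ≤ (1 + t ^ 2) * 1 := by gcongr
      _ = _ := by simp
  have hg2 : Integrable (fun t : ℝ => 4 / T ^ 3 * t ^ 2) (gaussianReal 0 v⁻¹) :=
    (integrable_sq_gaussianReal v⁻¹).const_mul _
  have hg : Integrable g (gaussianReal 0 v⁻¹) := (hg1.const_mul _).add hg2
  have hle : ∀ t, t ≠ 0 → 2 / |t| * ‖charFun ρ t - charFun (gaussianReal 0 1) t‖ ≤ g (-t) := by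
    intro t ht
    have ht0 : 0 < |t| := abs_pos.2 ht
    have hE : charFun (gaussianReal 0 1) t = cexp (-t ^ 2 / 2) := by
      rw [charFun_gaussianReal]; congr 1; simp; ring
    have ha : 0 ≤ 2 * A * r * ((1 + t ^ 2) * Real.exp (-t ^ 2 / 8)) := by positivity
    have hb : 0 ≤ 4 / T ^ 3 * t ^ 2 := by positivity
    simp only [g, neg_sq]
    rcases le_or_gt |t| T with h | h
    -- One factor `|t|` cancels the `2/|t|` of the inversion formula; the rest is `|t|^(1+δ) ≤ 1 +
    -- t²`.
    · have hp : |t| ^ (2 + δ) ≤ |t| * (1 + t ^ 2) := by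
        have e : |t| ^ (2 + δ) = |t| * |t| ^ (1 + δ) := by
          rw [← Real.rpow_one_add' ht0.le (by linarith)]; congr 1; ring
        rw [e]
        gcongr
        rcases le_or_gt |t| 1 with h' | h'
        · have := Real.rpow_le_one ht0.le h' (by linarith : 0 ≤ 1 + δ)
          nlinarith [sq_nonneg t]
        · have := Real.rpow_le_rpow_of_exponent_le h'.le (by linarith : 1 + δ ≤ 2)
          rw [Real.rpow_two, sq_abs] at this
          linarith
      have := hbound n hn t h
      rw [← hρ, ← hE] at this
      refine le_trans ?_ (le_add_of_nonneg_right hb)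
      calc _ ≤ 2 / |t| * (A * r * |t| ^ (2 + δ) * Real.exp (-t ^ 2 / 8)) := by gcongr
        _ ≤ 2 / |t| * (A * r * (|t| * (1 + t ^ 2)) * Real.exp (-t ^ 2 / 8)) := by gcongr
        _ = _ := by field_simp
    -- At high frequency the trivial bound `4/|t|` is enlarged to `4 t²/T³`, whose Gaussian integral
    -- is a known second moment.
    · refine le_trans ?_ (le_add_of_nonneg_left ha)
      have hn2 : ‖charFun ρ t - charFun (gaussianReal 0 1) t‖ ≤ 2 := by
        refine (norm_sub_le _ _).trans ?_
        have h3 := norm_charFun_le_one (μ := ρ) t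
        have h4 := norm_charFun_le_one (μ := gaussianReal 0 1) t
        linarith
      calc _ ≤ 2 / |t| * 2 := by gcongr
        _ = 4 / |t| ^ 3 * t ^ 2 := by rw [← sq_abs t]; field_simp; norm_num
        _ ≤ 4 / T ^ 3 * t ^ 2 := by gcongr
  have hB := abs_conv_gaussianReal_Iic_sub_le hv0 hg hle
  have hB2 : (√(2 * Real.pi * v))⁻¹ * ∫ t, g t ∂gaussianReal 0 v⁻¹ ≤
      2 * A * M * r + 4 / c ^ 3 * (n : ℝ) ^ (-3 / 8 : ℝ) := by
    have hsplit : ∫ t, g t ∂gaussianReal 0 v⁻¹ = 2 * A * r *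
        (∫ t, (1 + t ^ 2) * Real.exp (-t ^ 2 / 8) ∂gaussianReal 0 v⁻¹)
        + 4 / T ^ 3 * (v : ℝ)⁻¹ := by
      simp only [g]
      rw [integral_add (hg1.const_mul _) hg2, integral_const_mul, integral_const_mul,
        integral_sq_gaussianReal_zero]
      push_cast; rfl
    have hM := integral_gaussianReal_le_integral integrable_one_add_sq_mul_exp
      (fun t => by positivity) hv0
    have hv1 : (√(2 * Real.pi * v))⁻¹ ≤ (√(v : ℝ))⁻¹ := by
      have : (0 : ℝ) < v := by positivity
      gcongr
      nlinarith [Real.pi_gt_three]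
    have hpow : 4 / T ^ 3 * ((√(v : ℝ))⁻¹ * (v : ℝ)⁻¹) = 4 / c ^ 3 * (n : ℝ) ^ (-3 / 8 : ℝ) := by
      rw [hT, mul_pow, ← div_div, div_mul_eq_mul_div, mul_div_assoc]
      congr 1
      rw [hvr, Real.sqrt_eq_rpow, Real.sqrt_eq_rpow, ← Real.rpow_mul hn0.le, ← Real.rpow_neg hn0.le,
        ← Real.rpow_neg hn0.le, ← Real.rpow_add hn0, ← Real.rpow_natCast, ← Real.rpow_mul hn0.le,
        ← Real.rpow_sub hn0]
      congr 1; norm_num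
    rw [hsplit]
    calc _ = 2 * A * r * ((√(2 * Real.pi * v))⁻¹ *
          (∫ t, (1 + t ^ 2) * Real.exp (-t ^ 2 / 8) ∂gaussianReal 0 v⁻¹)) +
          4 / T ^ 3 * ((√(2 * Real.pi * v))⁻¹ * (v : ℝ)⁻¹) := by ring
      _ ≤ 2 * A * r * M + 4 / T ^ 3 * ((√(v : ℝ))⁻¹ * (v : ℝ)⁻¹) := by gcongr
      _ = _ := by rw [hpow]; ring
  have hfin := abs_measureReal_Iic_sub_gaussianReal_le (ν := ρ) (v := v)
    (a := (n : ℝ) ^ (-1 / 4 : ℝ)) (by positivity) (fun b => (hB b).trans hB2) x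
  have e1 : (v : ℝ) / ((n : ℝ) ^ (-1 / 4 : ℝ)) ^ 2 = (n : ℝ) ^ (-1 / 4 : ℝ) := by
    rw [hvr, ← Real.rpow_natCast, ← Real.rpow_mul hn0.le, ← Real.rpow_sub hn0]
    congr 1; norm_num
  rw [e1] at hfin
  have e2 : (n : ℝ) ^ (-1 / 4 : ℝ) ≤ r := Real.rpow_le_rpow_of_exponent_le hn1 (by linarith)
  have e3 : (n : ℝ) ^ (-3 / 8 : ℝ) ≤ r := Real.rpow_le_rpow_of_exponent_le hn1 (by linarith)
  have e4 : 4 / c ^ 3 * (n : ℝ) ^ (-3 / 8 : ℝ) ≤ 4 / c ^ 3 * r := by gcongr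
  linarith

end BerryEsseen

/-! ### Normal approximation for i.i.d. sums and its stability under perturbation. -/

section IID

open Set Filter
open scoped NNReal Topology

variable {Ω : Type*} [MeasurableSpace Ω] {μ : Measure Ω} [IsProbabilityMeasure μ] {δ : ℝ}

theorem exists_abs_measureReal_inv_sqrt_mul_sum_sub_cdf_le {ξ : ℕ → Ω → ℝ}
    (hindep : iIndepFun ξ μ) (hm : ∀ k, Measurable (ξ k))
    (hident : ∀ k, IdentDistrib (ξ k) (ξ 0) μ μ) (hδ0 : 0 < δ) (hδ : δ ≤ 1 / 2)
    (hint : Integrable (fun ω => |ξ 0 ω| ^ (2 + δ)) μ) (h2i : MemLp (ξ 0) 2 μ)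
    (h1 : ∫ ω, ξ 0 ω ∂μ = 0) (h2 : ∫ ω, ξ 0 ω ^ 2 ∂μ = 1) :
    ∃ C : ℝ, ∀ n : ℕ, 2 ≤ n → ∀ x : ℝ,
      |μ.real {ω | (√(n : ℝ))⁻¹ * ∑ k ∈ Finset.range n, ξ k ω ≤ x} - cdf (gaussianReal 0 1) x|
        ≤ C * (n : ℝ) ^ (-δ / 2) := by
  have hp : IsProbabilityMeasure (μ.map (ξ 0)) := Measure.isProbabilityMeasure_map (hm 0).aemeasurable
  have hi : ∀ {f : ℝ → ℝ}, Measurable f → Integrable (fun ω => f (ξ 0 ω)) μ →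
      Integrable f (μ.map (ξ 0)) := fun hf hfi =>
    (integrable_map_measure hf.aestronglyMeasurable (hm 0).aemeasurable).2 hfi
  have he : ∀ {f : ℝ → ℝ}, Measurable f → ∫ x, f x ∂(μ.map (ξ 0)) = ∫ ω, f (ξ 0 ω) ∂μ := fun hf =>
    integral_map (hm 0).aemeasurable hf.aestronglyMeasurable
  obtain ⟨C, hC⟩ := exists_abs_measureReal_Iic_sub_le (ν := μ.map (ξ 0)) hδ0 hδ
    (hi (by fun_prop) hint) (hi measurable_id (h2i.integrable one_le_two))
    (hi (by fun_prop) h2i.integrable_sq) ((he measurable_id).trans h1)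
    ((he (by fun_prop)).trans h2)
  refine ⟨C, fun n hn x => ?_⟩
  have hmS : Measurable fun ω => (√(n : ℝ))⁻¹ * ∑ k ∈ Finset.range n, ξ k ω := by fun_prop
  have hp' := Measure.isProbabilityMeasure_map (μ := μ) hmS.aemeasurable
  have := hC n hn (μ.map fun ω => (√(n : ℝ))⁻¹ * ∑ k ∈ Finset.range n, ξ k ω)
    (fun t => charFun_inv_sqrt_mul_sum hindep hident) x
  rwa [map_measureReal_apply hmS measurableSet_Iic, ← cdf_eq_real] at this

/-- Transfer of a normal approximation from `S` to a perturbation `W` of `S`. -/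
lemma abs_measureReal_le_sub_cdf_le_of_perturbation {S W U : Ω → ℝ} {B D η : ℝ}
    (hS : ∀ x, |μ.real {ω | S ω ≤ x} - cdf (gaussianReal 0 1) x| ≤ B)
    (hU : ∀ᵐ ω ∂μ, |W ω - S ω| ≤ U ω) (hUi : Integrable U μ) (hη : 0 < η)
    (hUD : ∫ ω, U ω ∂μ ≤ D * η ^ 2) (x : ℝ) :
    |μ.real {ω | W ω ≤ x} - cdf (gaussianReal 0 1) x| ≤ B + (D + 1) * η := by
  -- Markov's inequality: a mean of order `η²` makes the exceptional probability of order `η`,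
  -- matching the cost of shifting the argument by `η`.
  have hP : μ.real {ω | η ≤ U ω} ≤ D * η := by
    have := mul_meas_ge_le_integral_of_nonneg (μ := μ) (f := U)
      (hU.mono fun ω h => (abs_nonneg _).trans h) hUi η
    have h2 := this.trans hUD
    have h3 : η * μ.real {ω | η ≤ U ω} ≤ η * (D * η) := by
      refine h2.trans_eq ?_; ring
    exact le_of_mul_le_mul_left h3 hη
  have hnull : μ.real {ω | ¬ |W ω - S ω| ≤ U ω} = 0 := by
    rw [Measure.real, ae_iff.1 hU, ENNReal.toReal_zero]
  -- Stated for a general pair so that it serves for `(W, S)` and, reversed, for `(S, W)`.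
  have hup : ∀ {V V' : Ω → ℝ} (y : ℝ), (∀ ω, |V ω - V' ω| = |W ω - S ω|) →
      μ.real {ω | V ω ≤ y} ≤ μ.real {ω | V' ω ≤ y + η} + D * η := fun {V V'} y hV => by
    have hsub : {ω | V ω ≤ y} ⊆ ({ω | V' ω ≤ y + η} ∪ {ω | η ≤ U ω}) ∪
        {ω | ¬ |W ω - S ω| ≤ U ω} := fun ω hω => by
      simp only [mem_ofPred_eq, mem_union] at hω ⊢
      by_contra! h
      have := (abs_le.1 (hV ω).le).1
      linarith
    have := (measureReal_mono (μ := μ) hsub).trans ((measureReal_union_le _ _).trans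
      (add_le_add_left (measureReal_union_le _ _) _))
    linarith
  have hΦ : ∀ y, cdf (gaussianReal 0 1) (y + η) ≤ cdf (gaussianReal 0 1) y + η := fun y => by
    rw [cdf_eq_real, cdf_eq_real]; exact gaussianReal_Iic_add_le y hη.le
  have a1 := hup (V := W) (V' := S) x fun _ => rfl
  have a2 := hup (V := S) (V' := W) (x - η) fun ω => abs_sub_comm _ _
  rw [sub_add_cancel] at a2
  have b1 := abs_le.1 (hS (x + η))
  have b2 := abs_le.1 (hS (x - η))
  have c1 := hΦ x
  have c2 := hΦ (x - η)
  rw [sub_add_cancel] at c2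
  rw [abs_le]
  constructor <;> linarith [b1.2, b2.1]

end IID

/-! ### Pathwise inequalities for the plug-in and jackknife entropies. -/

section Deterministic

open Finset

variable {n : ℕ} {x : ℕ → ℕ+}

/-- The letters observed among `x 0, …, x (n - 1)`. -/
def observedLetters (n : ℕ) (x : ℕ → ℕ+) : Finset ℕ+ := (range n).image x

lemma mem_observedLetters {k : ℕ} (hk : k ∈ range n) : x k ∈ observedLetters n x :=
  mem_image_of_mem x hk

lemma letterInd_nonneg (y i : ℕ+) : 0 ≤ letterInd y i := by unfold letterInd; split_ifs <;> norm_num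

lemma letterInd_mul_self (y i : ℕ+) : letterInd y i * letterInd y i = letterInd y i := by
  unfold letterInd; split_ifs <;> norm_num

lemma letterInd_eq_zero {k : ℕ} (hk : k ∈ range n) {i : ℕ+} (hi : i ∉ observedLetters n x) :
    letterInd (x k) i = 0 := by
  rw [letterInd, if_neg]
  rintro rfl
  exact hi (mem_observedLetters hk)

lemma sampleProp_nonneg (i : ℕ+) : 0 ≤ sampleProp n x i :=
  mul_nonneg (by positivity) (sum_nonneg fun _ _ => letterInd_nonneg _ _)

lemma sampleProp_eq_zero {i : ℕ+} (hi : i ∉ observedLetters n x) : sampleProp n x i = 0 := by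
  rw [sampleProp, sum_eq_zero fun k hk => letterInd_eq_zero hk hi, mul_zero]

lemma one_le_sum_letterInd {i : ℕ+} (hi : i ∈ observedLetters n x) :
    1 ≤ ∑ k ∈ range n, letterInd (x k) i := by
  obtain ⟨k, hk, rfl⟩ := mem_image.1 hi
  refine le_trans ?_ (single_le_sum (f := fun j => letterInd (x j) (x k))
    (fun _ _ => letterInd_nonneg _ _) hk)
  simp [letterInd]

lemma sampleProp_le_one (i : ℕ+) : sampleProp n x i ≤ 1 := by
  rcases Nat.eq_zero_or_pos n with rfl | hn
  · simp [sampleProp]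
  have : ∑ k ∈ range n, letterInd (x k) i ≤ ∑ k ∈ range n, 1 :=
    sum_le_sum fun k _ => by unfold letterInd; split_ifs <;> norm_num
  have hn' : (0 : ℝ) < n := by exact_mod_cast hn
  rw [sampleProp, one_div, inv_mul_le_iff₀ hn']
  simpa using this

lemma sampleProp_pos {i : ℕ+} (hi : i ∈ observedLetters n x) : 0 < sampleProp n x i := by
  have hn : 0 < n := by
    obtain ⟨k, hk, rfl⟩ := mem_image.1 hi
    exact (Nat.zero_le k).trans_lt (mem_range.1 hk)
  have := one_le_sum_letterInd hi
  rw [sampleProp]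
  positivity

lemma sum_sampleProp_mul (s : Finset ℕ+) (f : ℕ+ → ℝ) :
    ∑ i ∈ s, sampleProp n x i * f i =
      (1 / (n : ℝ)) * ∑ k ∈ range n, if x k ∈ s then f (x k) else 0 := by
  simp_rw [sampleProp, mul_assoc, ← mul_sum, sum_mul]
  rw [sum_comm]
  congr 1
  refine sum_congr rfl fun k _ => ?_
  simp [letterInd]

lemma sum_observed_sampleProp_mul (f : ℕ+ → ℝ) :
    ∑ i ∈ observedLetters n x, sampleProp n x i * f i = (1 / (n : ℝ)) * ∑ k ∈ range n, f (x k) := by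
  rw [sum_sampleProp_mul]
  congr 1
  exact sum_congr rfl fun k hk => if_pos (mem_observedLetters hk)

lemma sum_observed_sampleProp (hn : n ≠ 0) : ∑ i ∈ observedLetters n x, sampleProp n x i = 1 := by
  have := sum_observed_sampleProp_mul (n := n) (x := x) fun _ => 1
  have hn' : (n : ℝ) ≠ 0 := by exact_mod_cast hn
  simpa [hn'] using this

lemma plugInEntropy_eq_sum : plugInEntropy n x =
    -∑ i ∈ observedLetters n x, sampleProp n x i * Real.log (sampleProp n x i) := by
  rw [plugInEntropy, shannonEntropy, tsum_eq_sum fun i hi => by rw [sampleProp_eq_zero hi, zero_mul]]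

/-- `ln t ≤ t - 1` at `t = m/r`; summed over letters, it is Gibbs' inequality. -/
lemma sub_le_mul_log_sub {r m : ℝ} (hr : 0 ≤ r) (hm : 0 < m) :
    r - m ≤ r * Real.log r - r * Real.log m := by
  rcases hr.eq_or_lt with rfl | hr
  · simp [hm.le]
  have h := Real.log_le_sub_one_of_pos (div_pos hm hr)
  rw [Real.log_div hm.ne' hr.ne'] at h
  have h2 : r * (Real.log m - Real.log r) ≤ r * (m / r - 1) := by gcongr
  have h3 : r * (m / r - 1) = m - r := by field_simp
  linarith

/-- `ln t ≤ t - 1` at `t = r/m`; summed over letters, it bounds relative entropy by a chi-square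
quantity. -/
lemma mul_log_sub_le {r m : ℝ} (hr : 0 ≤ r) (hm : 0 < m) :
    r * Real.log r - r * Real.log m ≤ r ^ 2 / m - r := by
  rcases hr.eq_or_lt with rfl | hr
  · simp
  have h := Real.log_le_sub_one_of_pos (div_pos hr hm)
  rw [Real.log_div hr.ne' hm.ne'] at h
  have h2 : r * (Real.log r - Real.log m) ≤ r * (r / m - 1) := by gcongr
  have h3 : r * (r / m - 1) = r ^ 2 / m - r := by ring
  linarith

variable {p : ℕ+ → ℝ}

/-- The plug-in entropy lies below the average of `-log p` over the sample. -/
lemma plugInEntropy_le (hn : n ≠ 0) (hp1 : ∀ s : Finset ℕ+, ∑ i ∈ s, p i ≤ 1)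
    (hpos : ∀ k, k < n → 0 < p (x k)) :
    plugInEntropy n x ≤ (1 / (n : ℝ)) * ∑ k ∈ range n, -Real.log (p (x k)) := by
  rw [← sum_observed_sampleProp_mul (fun i => -Real.log (p i)), plugInEntropy_eq_sum,
    ← sum_neg_distrib]
  have h : ∑ i ∈ observedLetters n x, (sampleProp n x i - p i) ≤
      ∑ i ∈ observedLetters n x, (sampleProp n x i * Real.log (sampleProp n x i) -
        sampleProp n x i * Real.log (p i)) := sum_le_sum fun i hi => by
    obtain ⟨k, hk, rfl⟩ := mem_image.1 hi
    exact sub_le_mul_log_sub (sampleProp_nonneg _) (hpos k (mem_range.1 hk))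
  rw [sum_sub_distrib, sum_sub_distrib, sum_observed_sampleProp hn] at h
  have h1 := hp1 (observedLetters n x)
  simp only [mul_neg, sum_neg_distrib]
  linarith

/-- An upper bound on the deficit of the plug-in entropy; `G` collects the frequent letters. -/
lemma le_plugInEntropy_add {G : Finset ℕ+}
    (hG : ∀ i ∈ G, 0 < p i) :
    (1 / (n : ℝ)) * ∑ k ∈ range n, -Real.log (p (x k)) ≤ plugInEntropy n x +
      (∑ i ∈ G, (sampleProp n x i ^ 2 / p i - sampleProp n x i) +
        (1 / (n : ℝ)) * ∑ k ∈ range n, if x k ∉ G then -Real.log (p (x k)) else 0) := by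
  set T := observedLetters n x with hT
  set q := sampleProp n x with hq
  have e1 : (1 / (n : ℝ)) * ∑ k ∈ range n, (if x k ∉ G then -Real.log (p (x k)) else 0)
      = ∑ i ∈ T, q i * (if i ∉ G then -Real.log (p i) else 0) :=
    (sum_observed_sampleProp_mul (fun i => if i ∉ G then -Real.log (p i) else 0)).symm
  have e2 : ∑ i ∈ G, (q i ^ 2 / p i - q i) = ∑ i ∈ T, if i ∈ G then q i ^ 2 / p i - q i else 0 := by
    rw [← sum_filter, filter_mem_eq_inter, inter_comm]
    refine (sum_subset inter_subset_left fun i hi hi2 => ?_).symm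
    have : q i = 0 := sampleProp_eq_zero fun h => hi2 (mem_inter.2 ⟨hi, h⟩)
    simp [this]
  rw [e1, e2, ← sum_observed_sampleProp_mul (fun i => -Real.log (p i)), plugInEntropy_eq_sum,
    ← sum_neg_distrib, ← sum_add_distrib, ← sum_add_distrib]
  refine sum_le_sum fun i hi => ?_
  by_cases h : i ∈ G
  · simp only [h, not_true_eq_false, if_true, if_false]
    have := mul_log_sub_le (r := q i) (sampleProp_nonneg i) (hG i h)
    linarith
  -- Outside `G` the term `q ln q ≤ 0` is simply dropped and only `-q ln p` is kept.
  · simp only [h, not_false_eq_true, if_true, if_false]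
    have := mul_nonpos_of_nonneg_of_nonpos (sampleProp_nonneg (n := n) (x := x) i)
      (Real.log_nonpos (sampleProp_nonneg (n := n) (x := x) i) (sampleProp_le_one i))
    linarith

lemma shannonEntropy_looSampleProp {j : ℕ} (hj : j ∈ range n) :
    shannonEntropy (looSampleProp n x j) =
      -∑ i ∈ observedLetters n x, looSampleProp n x j i * Real.log (looSampleProp n x j i) := by
  rw [shannonEntropy, tsum_eq_sum fun i hi => ?_]
  rw [looSampleProp, sum_eq_zero fun k hk => letterInd_eq_zero hk hi, letterInd_eq_zero hj hi]
  simp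

lemma looSampleProp_nonneg (hn : 2 ≤ n) {j : ℕ} (hj : j ∈ range n) (i : ℕ+) :
    0 ≤ looSampleProp n x j i := by
  have h2 : (2 : ℝ) ≤ n := by exact_mod_cast hn
  refine mul_nonneg (one_div_nonneg.2 (by linarith)) (sub_nonneg.2 ?_)
  exact single_le_sum (f := fun k => letterInd (x k) i) (fun _ _ => letterInd_nonneg _ _) hj

/-- The gap in Jensen's inequality for `t ↦ t * log t` and the leave-one-out proportions. -/
lemma sum_looSampleProp_mul_log_sub_mem_Icc (hn : 2 ≤ n) {i : ℕ+} (hi : i ∈ observedLetters n x) :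
    (∑ j ∈ range n, looSampleProp n x j i * Real.log (looSampleProp n x j i)) / n -
      sampleProp n x i * Real.log (sampleProp n x i) ∈ Set.Icc 0 (1 / ((n : ℝ) * (n - 1))) := by
  have h2 : (2 : ℝ) ≤ n := by exact_mod_cast hn
  have hn0 : (0 : ℝ) < n := by linarith
  have hn1 : (0 : ℝ) < n - 1 := by linarith
  have hq := sampleProp_pos hi
  set m := sampleProp n x i with hm
  set Y := ∑ k ∈ range n, letterInd (x k) i with hY
  have hY1 : 1 ≤ Y := one_le_sum_letterInd hi
  have hmY : m = Y / n := by rw [hm, sampleProp]; ring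
  -- The leave-one-out proportions average over `j` to the full proportion `m`, so the linear terms
  -- cancel and the gap lies between `0` and their variance divided by `m`.
  have hs1 : ∑ j ∈ range n, looSampleProp n x j i = Y := by
    simp only [looSampleProp]
    rw [← mul_sum, sum_sub_distrib, ← hY]
    simp only [sum_const, card_range, nsmul_eq_mul]
    field_simp
  have hs2 : ∑ j ∈ range n, looSampleProp n x j i ^ 2 = (n * Y ^ 2 - 2 * Y ^ 2 + Y) / (n - 1) ^ 2 := by
    have : ∀ j, looSampleProp n x j i ^ 2 = (1 / ((n : ℝ) - 1)) ^ 2 *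
        (Y ^ 2 - 2 * Y * letterInd (x j) i + letterInd (x j) i) := fun j => by
      rw [looSampleProp, ← hY, mul_pow]
      linear_combination (1 / ((n : ℝ) - 1)) ^ 2 * letterInd_mul_self (x j) i
    simp_rw [this]
    rw [← mul_sum, sum_add_distrib, sum_sub_distrib, ← mul_sum, ← hY]
    simp only [sum_const, card_range, nsmul_eq_mul]
    field_simp
  have hlow := sum_le_sum fun j hj => sub_le_mul_log_sub (looSampleProp_nonneg (x := x) hn hj i) hq
  have hupp := sum_le_sum fun j hj => mul_log_sub_le (looSampleProp_nonneg (x := x) hn hj i) hq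
  rw [sum_sub_distrib, sum_sub_distrib, ← sum_mul, hs1] at hlow hupp
  rw [← sum_div, hs2] at hupp
  simp only [sum_const, card_range, nsmul_eq_mul] at hlow
  have hYn : Y = n * m := by rw [hmY]; field_simp
  have hF : ∀ F : ℝ, F / n - m * Real.log m = (F - Y * Real.log m) / n := fun F => by
    rw [hYn]; field_simp
  rw [hF, Set.mem_Icc]
  constructor
  · exact div_nonneg (by linarith) hn0.le
  · rw [div_le_iff₀ hn0]
    refine hupp.trans ?_
    -- The letter is observed, so `Y ≥ 1` and `n - Y ≤ n - 1`: one factor `n - 1` cancels.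
    have e : (n * Y ^ 2 - 2 * Y ^ 2 + Y) / (n - 1) ^ 2 / m - Y = (n - Y) / (n - 1) ^ 2 := by
      rw [hmY]; field_simp; ring
    rw [e, div_le_iff₀ (by positivity)]
    have : 1 / ((n : ℝ) * (n - 1)) * n * (n - 1) ^ 2 = n - 1 := by field_simp
    linarith

lemma jackknifeEntropy_sub_plugInEntropy_mem_Icc (hn : 2 ≤ n) :
    jackknifeEntropy n x - plugInEntropy n x ∈ Set.Icc 0 (((observedLetters n x).card : ℝ) / n) := by
  have h2 : (2 : ℝ) ≤ n := by exact_mod_cast hn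
  have hn0 : (0 : ℝ) < n := by linarith
  have hn1 : (0 : ℝ) < n - 1 := by linarith
  -- The correction equals `n - 1` times the plug-in entropy minus the mean leave-one-out entropy.
  have e : jackknifeEntropy n x - plugInEntropy n x = ((n : ℝ) - 1) * ∑ i ∈ observedLetters n x,
      ((∑ j ∈ range n, looSampleProp n x j i * Real.log (looSampleProp n x j i)) / n -
        sampleProp n x i * Real.log (sampleProp n x i)) := by
    rw [jackknifeEntropy, sum_congr rfl fun j hj => shannonEntropy_looSampleProp hj,
      sum_neg_distrib, sum_comm, sum_sub_distrib, ← sum_div, plugInEntropy_eq_sum]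
    ring
  have hj := fun i (hi : i ∈ observedLetters n x) => sum_looSampleProp_mul_log_sub_mem_Icc hn hi
  rw [e]
  constructor
  · exact mul_nonneg hn1.le (sum_nonneg fun i hi => (hj i hi).1)
  · have := mul_le_mul_of_nonneg_left (sum_le_sum fun i hi => (hj i hi).2) hn1.le
    refine this.trans_eq ?_
    simp only [sum_const, nsmul_eq_mul]
    field_simp

end Deterministic

/-! ### Moments of the sample proportions and of the number of observed letters. -/

section Expectation

open Set Filter

instance instDiscreteMeasurableSpaceLetters : DiscreteMeasurableSpace ℕ+ := ⟨fun _ => trivial⟩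

variable {Ω : Type*} [MeasurableSpace Ω] {μ : Measure Ω}
  {X : ℕ → Ω → ℕ+} {p : ℕ+ → ℝ}

lemma measurable_comp_letter (hX : ∀ k, Measurable (X k)) (k : ℕ) (f : ℕ+ → ℝ) :
    Measurable fun ω => f (X k ω) :=
  (Measurable.of_discrete (f := f)).comp (hX k)

lemma measureReal_map_singleton (hX : ∀ k, Measurable (X k))
    (hp : ∀ k i, μ.real {ω | X k ω = i} = p i) (k : ℕ) (i : ℕ+) : (μ.map (X k)).real {i} = p i := by
  rw [map_measureReal_apply (hX k) (measurableSet_singleton i), ← hp k i]; rfl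

lemma letter_prob_nonneg (hp : ∀ k i, μ.real {ω | X k ω = i} = p i) (i : ℕ+) : 0 ≤ p i :=
  hp 0 i ▸ measureReal_nonneg

lemma integral_comp_letter (hX : ∀ k, Measurable (X k))
    (hp : ∀ k i, μ.real {ω | X k ω = i} = p i) (k : ℕ) {f : ℕ+ → ℝ}
    (hf : Integrable (fun ω => f (X k ω)) μ) : ∫ ω, f (X k ω) ∂μ = ∑' i, p i * f i := by
  have hs : AEStronglyMeasurable f (μ.map (X k)) :=
    (Measurable.of_discrete (f := f)).aestronglyMeasurable
  rw [← integral_map (hX k).aemeasurable hs,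
    integral_countable ((integrable_map_measure hs (hX k).aemeasurable).2 hf)]
  simp_rw [measureReal_map_singleton hX hp, smul_eq_mul]

variable [IsProbabilityMeasure μ]

lemma identDistrib_letters (hX : ∀ k, Measurable (X k))
    (hp : ∀ k i, μ.real {ω | X k ω = i} = p i) (k : ℕ) : IdentDistrib (X k) (X 0) μ μ where
  aemeasurable_fst := (hX k).aemeasurable
  aemeasurable_snd := (hX 0).aemeasurable
  map_eq := by
    have h1 := Measure.isProbabilityMeasure_map (μ := μ) (hX k).aemeasurable
    have h2 := Measure.isProbabilityMeasure_map (μ := μ) (hX 0).aemeasurable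
    refine Measure.ext_of_singleton fun i => ?_
    rw [← ENNReal.toReal_eq_toReal_iff' (measure_ne_top _ _) (measure_ne_top _ _)]
    exact (measureReal_map_singleton hX hp k i).trans (measureReal_map_singleton hX hp 0 i).symm

lemma sum_letter_prob_le_one (hX : ∀ k, Measurable (X k))
    (hp : ∀ k i, μ.real {ω | X k ω = i} = p i) (s : Finset ℕ+) : ∑ i ∈ s, p i ≤ 1 := by
  have := Measure.isProbabilityMeasure_map (μ := μ) (hX 0).aemeasurable
  have h : ∑ i ∈ s, (μ.map (X 0)).real {i} ≤ 1 := by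
    rw [sum_measureReal_singleton]; exact measureReal_le_one
  simpa only [measureReal_map_singleton hX hp] using h

/-- The alphabet is countable, so almost surely no null letter ever occurs. This keeps the default
value `Real.log 0 = 0` out of the entropy inequalities. -/
lemma ae_letter_prob_pos (hp : ∀ k i, μ.real {ω | X k ω = i} = p i) :
    ∀ᵐ ω ∂μ, ∀ k, 0 < p (X k ω) := by
  rw [ae_all_iff]
  intro k
  have h : ∀ᵐ ω ∂μ, ∀ i, p i = 0 → X k ω ≠ i := by
    rw [ae_all_iff]
    intro i
    by_cases hi : p i = 0
    · have : μ {ω | X k ω = i} = 0 := by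
        rw [← hp k i, measureReal_eq_zero_iff] at hi
        exact hi
      have : ∀ᵐ ω ∂μ, X k ω ≠ i := by
        rw [ae_iff]; simpa using this
      exact this.mono fun ω h _ => h
    · exact ae_of_all _ fun ω h => absurd h hi
  filter_upwards [h] with ω hω
  exact (letter_prob_nonneg hp _).lt_of_ne fun h0 => hω _ h0.symm rfl

lemma memLp_comp_of_bounded (hX : ∀ k, Measurable (X k)) (k : ℕ) {f : ℕ+ → ℝ} {c : ℝ}
    (hf : ∀ i, |f i| ≤ c) : MemLp (fun ω => f (X k ω)) 2 μ :=
  MemLp.of_bound (measurable_comp_letter hX k f).aestronglyMeasurable c (ae_of_all _ fun _ => hf _)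

lemma abs_letterInd_le_one (y i : ℕ+) : |letterInd y i| ≤ 1 := by
  unfold letterInd; split_ifs <;> norm_num

lemma integral_letterInd (hX : ∀ k, Measurable (X k))
    (hp : ∀ k i, μ.real {ω | X k ω = i} = p i) (k : ℕ) (i : ℕ+) :
    ∫ ω, letterInd (X k ω) i ∂μ = p i := by
  rw [integral_comp_letter hX hp k (f := fun y => letterInd y i)
    ((memLp_comp_of_bounded hX k fun y => abs_letterInd_le_one y i).integrable one_le_two),
    tsum_eq_single i fun j hj => by rw [letterInd, if_neg hj, mul_zero], letterInd, if_pos rfl,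
    mul_one]

lemma memLp_sampleProp (hX : ∀ k, Measurable (X k)) (n : ℕ) (i : ℕ+) :
    MemLp (fun ω => sampleProp n (fun k => X k ω) i) 2 μ := by
  unfold sampleProp
  exact (memLp_finsetSum _ fun k _ =>
    memLp_comp_of_bounded hX k fun y => abs_letterInd_le_one y i).const_mul _

lemma integral_sampleProp (hX : ∀ k, Measurable (X k))
    (hp : ∀ k i, μ.real {ω | X k ω = i} = p i) {n : ℕ} (hn : n ≠ 0) (i : ℕ+) :
    ∫ ω, sampleProp n (fun k => X k ω) i ∂μ = p i := by
  simp only [sampleProp]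
  rw [integral_const_mul, integral_finsetSum]
  · simp_rw [integral_letterInd hX hp]
    have hn' : (n : ℝ) ≠ 0 := by exact_mod_cast hn
    simp [hn']
  · exact fun k _ => (memLp_comp_of_bounded hX k fun y => abs_letterInd_le_one y i).integrable
      one_le_two

lemma integral_sampleProp_sq (hX : ∀ k, Measurable (X k)) (hindep : iIndepFun X μ)
    (hp : ∀ k i, μ.real {ω | X k ω = i} = p i) {n : ℕ} (hn : n ≠ 0) (i : ℕ+) :
    ∫ ω, sampleProp n (fun k => X k ω) i ^ 2 ∂μ = p i * (1 - p i) / n + p i ^ 2 := by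
  have hn' : (n : ℝ) ≠ 0 := by exact_mod_cast hn
  have hL : ∀ k, MemLp (fun ω => letterInd (X k ω) i) 2 μ := fun k =>
    memLp_comp_of_bounded hX k fun y => abs_letterInd_le_one y i
  have hv1 : ∀ k, Var[fun ω => letterInd (X k ω) i; μ] = p i * (1 - p i) := fun k => by
    rw [variance_eq_sub (hL k)]
    have : ((fun ω => letterInd (X k ω) i) ^ 2) = fun ω => letterInd (X k ω) i := by
      ext ω; simp only [Pi.pow_apply, sq, letterInd_mul_self]
    rw [this, integral_letterInd hX hp]; ring
  have hvs : Var[fun ω => ∑ k ∈ Finset.range n, letterInd (X k ω) i; μ] = n * (p i * (1 - p i)) := by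
    have h := IndepFun.variance_sum (μ := μ) (s := Finset.range n)
      (X := fun k ω => letterInd (X k ω) i) (fun k _ => hL k) (fun k _ l _ hkl =>
        (hindep.indepFun hkl).comp (φ := fun y => letterInd y i) (ψ := fun y => letterInd y i)
          Measurable.of_discrete Measurable.of_discrete)
    simp only [hv1, Finset.sum_const, Finset.card_range, nsmul_eq_mul] at h
    rw [← h]
    congr 1; ext ω; simp
  have hv := variance_eq_sub (memLp_sampleProp (μ := μ) hX n i)
  have hv2 : Var[fun ω => sampleProp n (fun k => X k ω) i; μ] = p i * (1 - p i) / n := by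
    simp only [sampleProp]
    rw [variance_const_mul, hvs]
    field_simp
  rw [hv2, integral_sampleProp hX hp hn] at hv
  have e : ((fun ω => sampleProp n (fun k => X k ω) i) ^ 2) =
      fun ω => sampleProp n (fun k => X k ω) i ^ 2 := rfl
  rw [e] at hv
  linarith

/-- The expected chi-square-type statistic over a finite set of letters. -/
lemma integral_sum_sampleProp_sq_div_sub_le (hX : ∀ k, Measurable (X k)) (hindep : iIndepFun X μ)
    (hp : ∀ k i, μ.real {ω | X k ω = i} = p i) {n : ℕ} (hn : n ≠ 0) {G : Finset ℕ+}
    (hG : ∀ i ∈ G, 0 < p i) :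
    Integrable (fun ω => ∑ i ∈ G, (sampleProp n (fun k => X k ω) i ^ 2 / p i
      - sampleProp n (fun k => X k ω) i)) μ ∧
    ∫ ω, ∑ i ∈ G, (sampleProp n (fun k => X k ω) i ^ 2 / p i
      - sampleProp n (fun k => X k ω) i) ∂μ ≤ (G.card : ℝ) / n := by
  have hi : ∀ i, Integrable (fun ω => sampleProp n (fun k => X k ω) i) μ := fun i =>
    (memLp_sampleProp hX n i).integrable one_le_two
  have hi2 : ∀ i, Integrable (fun ω => sampleProp n (fun k => X k ω) i ^ 2 / p i) μ := fun i =>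
    (memLp_sampleProp hX n i).integrable_sq.div_const _
  have hi3 : ∀ i ∈ G, Integrable (fun ω => sampleProp n (fun k => X k ω) i ^ 2 / p i
      - sampleProp n (fun k => X k ω) i) μ := fun i _ => (hi2 i).sub (hi i)
  refine ⟨integrable_finsetSum _ hi3, ?_⟩
  rw [integral_finsetSum _ hi3, div_eq_mul_inv, ← nsmul_eq_mul]
  refine Finset.sum_le_card_nsmul _ _ _ fun i hiG => ?_
  have hpi := hG i hiG
  have hn' : (0 : ℝ) < n := by positivity
  rw [integral_sub (hi2 i) (hi i), integral_div, integral_sampleProp_sq hX hindep hp hn,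
    integral_sampleProp hX hp hn]
  -- Each letter contributes exactly `(1 - p i)/n` in expectation, however small `p i` is.
  have : (p i * (1 - p i) / n + p i ^ 2) / p i - p i = (1 - p i) * (n : ℝ)⁻¹ := by field_simp; ring
  rw [this]
  have h0 : 0 < (n : ℝ)⁻¹ := by positivity
  nlinarith

/-- The count factors through the first `n` observations, which take values in a countable discrete
space. -/
lemma measurable_card_observedLetters (hX : ∀ k, Measurable (X k)) (n : ℕ) :
    Measurable fun ω => ((observedLetters n fun k => X k ω).card : ℝ) := by
  have h : (fun ω => ((observedLetters n fun k => X k ω).card : ℝ)) =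
      (fun y : Fin n → ℕ+ => ((Finset.univ.image y).card : ℝ)) ∘ fun ω (k : Fin n) => X k ω := by
    ext ω
    simp only [Function.comp, observedLetters]
    congr 2
    ext i
    simp only [Finset.mem_image, Finset.mem_range, Finset.mem_univ, true_and]
    exact ⟨fun ⟨k, hk, h⟩ => ⟨⟨k, hk⟩, h⟩, fun ⟨k, h⟩ => ⟨k, k.2, h⟩⟩
  rw [h]
  exact (Measurable.of_discrete).comp (measurable_pi_lambda _ fun k => hX k)

lemma card_observedLetters_le (n : ℕ) (x : ℕ → ℕ+) : (observedLetters n x).card ≤ n :=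
  Finset.card_image_le.trans_eq (Finset.card_range n)

lemma integrable_card_observedLetters (hX : ∀ k, Measurable (X k)) (n : ℕ) :
    Integrable (fun ω => ((observedLetters n fun k => X k ω).card : ℝ)) μ :=
  Integrable.of_bound (measurable_card_observedLetters hX n).aestronglyMeasurable n
    (ae_of_all _ fun ω => by
      rw [Real.norm_of_nonneg (by positivity)]; exact_mod_cast card_observedLetters_le _ _)

lemma min_one_le_rpow {y s : ℝ} (hy : 0 ≤ y) (hs0 : 0 < s) (hs : s ≤ 1) : min 1 y ≤ y ^ s := by
  rcases le_or_gt y 1 with h | h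
  · exact (min_le_right _ _).trans (Real.self_le_rpow_of_le_one hy h hs)
  · exact (min_le_left _ _).trans (Real.one_le_rpow h.le hs0.le)

/-- The expected number of distinct letters in a sample. -/
lemma integral_card_observedLetters_le (hX : ∀ k, Measurable (X k))
    (hp : ∀ k i, μ.real {ω | X k ω = i} = p i) (n : ℕ) {s : ℝ} (hs0 : 0 < s) (hs : s ≤ 1)
    (hsum : Summable fun i => p i ^ s) :
    ∫ ω, ((observedLetters n fun k => X k ω).card : ℝ) ∂μ ≤ (n : ℝ) ^ s * ∑' i, p i ^ s := by
  have hp0 := letter_prob_nonneg hp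
  have hmem : ∀ i, MeasurableSet {ω | i ∈ observedLetters n fun k => X k ω} := fun i => by
    have : {ω | i ∈ observedLetters n fun k => X k ω} =
        ⋃ k ∈ Finset.range n, {ω | X k ω = i} := by
      ext ω; simp [observedLetters]
    rw [this]
    exact Finset.measurableSet_biUnion _ fun k _ => hX k (measurableSet_singleton i)
  have hprob : ∀ i, μ {ω | i ∈ observedLetters n fun k => X k ω} ≤
      ENNReal.ofReal ((n : ℝ) ^ s * p i ^ s) := fun i => by
    rw [← ofReal_measureReal]
    refine ENNReal.ofReal_le_ofReal ?_
    rw [← Real.mul_rpow (by positivity) (hp0 i)]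
    -- A letter is seen with probability at most `min 1 (n p) ≤ (n p)^s`, the second entry being the
    -- union bound.
    refine le_trans (le_min measureReal_le_one ?_)
      (min_one_le_rpow (mul_nonneg (by positivity) (hp0 i)) hs0 hs)
    have hsub : {ω | i ∈ observedLetters n fun k => X k ω} ⊆
        ⋃ k ∈ Finset.range n, {ω | X k ω = i} := fun ω hω => by
      simpa [observedLetters] using hω
    refine (measureReal_mono hsub (measure_ne_top _ _)).trans ((measureReal_biUnion_finset_le _ _).trans ?_)
    simp [hp]
  -- The count as a sum of indicators, in `ENNReal` so that sum and integral commute freely.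
  have hcard : ∀ ω, ENNReal.ofReal ((observedLetters n fun k => X k ω).card : ℝ) =
      ∑' i, {ω | i ∈ observedLetters n fun k => X k ω}.indicator (1 : Ω → ENNReal) ω := fun ω => by
    rw [tsum_eq_sum (s := observedLetters n fun k => X k ω)
      fun i hi => Set.indicator_of_notMem (by simpa using hi) _]
    rw [Finset.sum_congr rfl fun i hi => Set.indicator_of_mem (by simpa using hi) _]
    simp
  rw [integral_eq_lintegral_of_nonneg_ae (ae_of_all _ fun ω => by positivity)
    (measurable_card_observedLetters hX n).aestronglyMeasurable]
  refine ENNReal.toReal_le_of_le_ofReal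
    (mul_nonneg (by positivity) (tsum_nonneg fun i => Real.rpow_nonneg (hp0 i) _)) ?_
  simp_rw [hcard]
  rw [lintegral_tsum fun i => (measurable_one.indicator (hmem i)).aemeasurable]
  simp_rw [lintegral_indicator_one (hmem _)]
  refine (ENNReal.tsum_le_tsum hprob).trans_eq ?_
  rw [← ENNReal.ofReal_tsum_of_nonneg
    (fun i => mul_nonneg (by positivity) (Real.rpow_nonneg (hp0 i) _)) (hsum.mul_left _),
    tsum_mul_left]

end Expectation

/-! ### Mean distance between the jackknife estimator and the average of `-ln p`. -/

section Jackknife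

open Set Filter

variable {Ω : Type*} [MeasurableSpace Ω] {μ : Measure Ω}
  {X : ℕ → Ω → ℕ+} {p : ℕ+ → ℝ}

/-- The letters of positive probability with labels below `K`. -/
noncomputable def frequentLetters (p : ℕ+ → ℝ) (K : ℤ) : Finset ℕ+ :=
  open scoped Classical in
  -- `Nat.succPNat` shifts by one, so the image is the labels `1, …, K` (empty if `K ≤ 0`); the
  -- filter removes `K` itself.
  ((Finset.range K.toNat).image Nat.succPNat).filter fun i => ((i : ℕ) : ℤ) < K ∧ 0 < p i

lemma mem_frequentLetters {K : ℤ} {i : ℕ+} :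
    i ∈ frequentLetters p K ↔ ((i : ℕ) : ℤ) < K ∧ 0 < p i := by
  simp only [frequentLetters, Finset.mem_filter, Finset.mem_image, Finset.mem_range,
    and_iff_right_iff_imp]
  rintro ⟨h, -⟩
  refine ⟨(i : ℕ) - 1, ?_, ?_⟩
  · have := i.pos; omega
  · exact PNat.succPNat_natPred i

lemma card_frequentLetters_le (K : ℤ) : ((frequentLetters p K).card : ℝ) ≤ max (K : ℝ) 0 := by
  have h : (frequentLetters p K).card ≤ K.toNat :=
    (Finset.card_filter_le _ _).trans (Finset.card_image_le.trans_eq (Finset.card_range _))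
  have h2 : ((frequentLetters p K).card : ℤ) ≤ max K 0 := by
    rw [← Int.toNat_eq_max]; exact_mod_cast h
  exact_mod_cast h2

/-- A letter outside `frequentLetters p K` has label at least `K` or probability zero, and the
latter adds nothing to the expectation. -/
lemma integral_notMem_frequentLetters (hX : ∀ k, Measurable (X k))
    (hp : ∀ k i, μ.real {ω | X k ω = i} = p i)
    (hlog : ∀ k, Integrable (fun ω => -Real.log (p (X k ω))) μ) (K : ℤ) (k : ℕ) :
    Integrable (fun ω => if X k ω ∉ frequentLetters p K then -Real.log (p (X k ω)) else 0) μ ∧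
    ∫ ω, (if X k ω ∉ frequentLetters p K then -Real.log (p (X k ω)) else 0) ∂μ =
      -tailSum K fun i => p i * Real.log (p i) := by
  have hi : Integrable (fun ω => if X k ω ∉ frequentLetters p K then -Real.log (p (X k ω)) else 0)
      μ := by
    refine (hlog k).mono (measurable_comp_letter hX k
      (fun i => if i ∉ frequentLetters p K then -Real.log (p i) else 0)).aestronglyMeasurable
      (ae_of_all _ fun ω => ?_)
    split_ifs <;> simp
  refine ⟨hi, ?_⟩
  rw [integral_comp_letter hX hp k
    (f := fun i => if i ∉ frequentLetters p K then -Real.log (p i) else 0) hi, tailSum]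
  have := tsum_subtype {i : ℕ+ | K ≤ ((i : ℕ) : ℤ)} fun i => p i * Real.log (p i)
  refine Eq.trans ?_ (congrArg Neg.neg this.symm)
  rw [← tsum_neg]
  refine tsum_congr fun i => ?_
  by_cases hK : K ≤ ((i : ℕ) : ℤ)
  · rw [Set.indicator_of_mem (by exact hK), if_pos (by rw [mem_frequentLetters]; omega)]; ring
  · rw [Set.indicator_of_notMem (by exact hK)]
    rcases (letter_prob_nonneg hp i).eq_or_lt with h | h
    · simp [← h]
    · rw [if_neg (by rw [mem_frequentLetters]; exact fun h' => h' ⟨not_le.1 hK, h⟩)]; simp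

variable [IsProbabilityMeasure μ]

/-- The variance of `log p` under a nonuniform law is positive. -/
lemma variance_log_letter_prob_pos (hp : ∀ k i, μ.real {ω | X k ω = i} = p i)
    (hnonunif : IsNonuniform p)
    (hL : MemLp (fun ω => Real.log (p (X 0 ω))) 2 μ) :
    0 < Var[fun ω => Real.log (p (X 0 ω)); μ] := by
  refine (variance_nonneg _ _).lt_of_ne fun h0 => ?_
  have hev : evariance (fun ω => Real.log (p (X 0 ω))) μ = 0 := by
    rw [← ofReal_variance hL, ← h0, ENNReal.ofReal_zero]
  rw [evariance_eq_zero_iff hL.aestronglyMeasurable.aemeasurable] at hev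
  -- Zero variance makes `log p` almost surely constant, and an event of positive probability cannot
  -- avoid the constant; injectivity of `log` then forces uniformity.
  have key : ∀ i, p i ≠ 0 → Real.log (p i) = ∫ ω, Real.log (p (X 0 ω)) ∂μ := fun i hi => by
    by_contra hne
    refine hi ?_
    rw [← hp 0 i, measureReal_eq_zero_iff]
    refine measure_mono_null (fun ω hω => ?_) (ae_iff.1 hev)
    simp only [mem_ofPred_eq] at hω ⊢
    rwa [hω]
  obtain ⟨i, j, hi, hj, hij⟩ := hnonunif
  have hp0 := letter_prob_nonneg hp
  exact hij (Real.log_injOn_pos ((hp0 i).lt_of_ne hi.symm) ((hp0 j).lt_of_ne hj.symm)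
    ((key i hi).trans (key j hj).symm))

/-- The jackknife estimator is close in mean to the average of `-log p` over the sample. -/
lemma exists_abs_jackknifeEntropy_sub_le (hX : ∀ k, Measurable (X k)) (hindep : iIndepFun X μ)
    (hp : ∀ k i, μ.real {ω | X k ω = i} = p i)
    (hlog : ∀ k, Integrable (fun ω => -Real.log (p (X k ω))) μ) {s : ℝ} (hs0 : 0 < s) (hs : s ≤ 1)
    (hsum : Summable fun i => p i ^ s) (K : ℤ) {n : ℕ} (hn : 2 ≤ n) :
    ∃ U : Ω → ℝ, Integrable U μ ∧
      (∀ᵐ ω ∂μ, |jackknifeEntropy n (fun k => X k ω) -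
        (1 / (n : ℝ)) * ∑ k ∈ Finset.range n, -Real.log (p (X k ω))| ≤ U ω) ∧
      ∫ ω, U ω ∂μ ≤ max (K : ℝ) 0 / n - tailSum K (fun i => p i * Real.log (p i)) +
        (n : ℝ) ^ s / n * ∑' i, p i ^ s := by
  have hn0 : n ≠ 0 := by omega
  have hn' : (0 : ℝ) < n := by positivity
  set G := frequentLetters p K
  have hG : ∀ i ∈ G, 0 < p i := fun i hi => (mem_frequentLetters.1 hi).2
  obtain ⟨hA1, hA2⟩ := integral_sum_sampleProp_sq_div_sub_le hX hindep hp hn0 hG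
  have hT := integral_notMem_frequentLetters hX hp hlog K
  have hT1 : Integrable (fun ω => (1 / (n : ℝ)) * ∑ k ∈ Finset.range n,
      if X k ω ∉ G then -Real.log (p (X k ω)) else 0) μ :=
    (integrable_finsetSum _ fun k _ => (hT k).1).const_mul _
  have hT2 : ∫ ω, (1 / (n : ℝ)) * ∑ k ∈ Finset.range n,
      (if X k ω ∉ G then -Real.log (p (X k ω)) else 0) ∂μ =
      -tailSum K fun i => p i * Real.log (p i) := by
    rw [integral_const_mul, integral_finsetSum _ fun k _ => (hT k).1,
      Finset.sum_congr rfl fun k _ => (hT k).2]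
    simp only [Finset.sum_const, Finset.card_range, nsmul_eq_mul]
    field_simp
  have hC1 := (integrable_card_observedLetters (μ := μ) hX n).div_const (n : ℝ)
  -- The plug-in entropy lies below both quantities: below the average by at most the first two
  -- summands, below the jackknife by at most the third. Hence the sum bounds their distance.
  refine ⟨_, (hA1.add hT1).add hC1, ?_, ?_⟩
  · filter_upwards [ae_letter_prob_pos hp] with ω hω
    have h1 := plugInEntropy_le (x := fun k => X k ω) hn0 (sum_letter_prob_le_one hX hp)
      fun k _ => hω k
    have h2 := le_plugInEntropy_add (n := n) (x := fun k => X k ω) hG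
    have h3 := jackknifeEntropy_sub_plugInEntropy_mem_Icc (x := fun k => X k ω) hn
    simp only [Pi.add_apply]
    rw [abs_le]
    constructor <;> linarith [h3.1, h3.2]
  · rw [integral_add' (hA1.add hT1) hC1, integral_add' hA1 hT1, hT2, integral_div]
    have hc := integral_card_observedLetters_le hX hp n hs0 hs hsum
    have hk := card_frequentLetters_le (p := p) K
    have h4 : (G.card : ℝ) / n ≤ max (K : ℝ) 0 / n := by gcongr
    have h5 := div_le_div_of_nonneg_right hc hn'.le
    rw [mul_div_right_comm] at h5
    linarith

end Jackknife

/-- `X 0, X 1, X 2, …` are the observations `X₁, X₂, X₃, …`, and the letters of the alphabet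
are labelled by the positive integers. -/
theorem theorem3p3
    {Ω : Type*} [MeasurableSpace Ω] (μ : Measure Ω) [IsProbabilityMeasure μ]
    (X : ℕ → Ω → ℕ+) (hX : ∀ k, Measurable (X k)) (hindep : iIndepFun X μ)
    (p : ℕ+ → ℝ) (hp : ∀ k i, μ.real {ω | X k ω = i} = p i) (hnonunif : IsNonuniform p)
    (δ : ℝ) (hδ0 : 0 < δ) (hδ : δ < 1 / 2)
    (hmoment : Integrable (fun ω => |Real.log (p (X 0 ω))| ^ (2 + δ)) μ)
    (K : ℕ → ℤ) (C₀ : ℝ)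
    (hK : ∀ n : ℕ, 1 ≤ n → (K n : ℝ) ≤ (n : ℝ) ^ (1 / 2 - δ))
    (hK1 : ∀ n : ℕ, 1 ≤ n →
      (n : ℝ) ^ (1 / 2 + δ) * Real.log n * tailSum (K n) p ≤ C₀)
    (hK2 : ∀ n : ℕ, 1 ≤ n →
      -(n : ℝ) ^ (1 / 2 + δ) * tailSum (K n) (fun i => p i * Real.log (p i)) ≤ C₀)
    (ε : ℝ) (hε0 : 1 / 2 < ε) (hε : ε < 1)
    (hsum : Summable fun i => p i ^ (1 - ε)) :
    ∃ C : ℝ, ∀ n : ℕ, 2 ≤ n → ∀ x : ℝ,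
      |μ.real {ω | √(n : ℝ) / √(Var[fun ω => Real.log (p (X 0 ω)); μ]) *
            (jackknifeEntropy n (fun k => X k ω) - shannonEntropy p) ≤ x}
          - cdf (gaussianReal 0 1) x|
        ≤ C * (n : ℝ) ^ (-δ / 2) + C * (n : ℝ) ^ (1 / 4 - ε / 2) := by
  set L : ℕ → Ω → ℝ := fun k ω => Real.log (p (X k ω)) with hLdef
  have hmeas : ∀ f : ℕ+ → ℝ, Measurable f := fun f => Measurable.of_discrete
  have hLm : ∀ k, Measurable (L k) := fun k => measurable_comp_letter hX k fun i => Real.log (p i)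
  have hid : ∀ k, IdentDistrib (L k) (L 0) μ μ := fun k =>
    (identDistrib_letters hX hp k).comp (hmeas fun i => Real.log (p i))
  have hq0 : ENNReal.ofReal (2 + δ) ≠ 0 := by
    rw [Ne, ENNReal.ofReal_eq_zero]; linarith
  have hqr : (ENNReal.ofReal (2 + δ)).toReal = 2 + δ := ENNReal.toReal_ofReal (by linarith)
  have hLq : MemLp (L 0) (ENNReal.ofReal (2 + δ)) μ := by
    rw [← integrable_norm_rpow_iff (hLm 0).aestronglyMeasurable hq0 ENNReal.ofReal_ne_top, hqr]
    exact hmoment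
  have h2q : (2 : ENNReal) ≤ ENNReal.ofReal (2 + δ) := by
    rw [ENNReal.le_ofReal_iff_toReal_le (by simp) (by linarith)]; simp [hδ0.le]
  have hL2 : MemLp (L 0) 2 μ := hLq.mono_exponent h2q
  have hL1 : Integrable (L 0) μ := hL2.integrable one_le_two
  have hlog : ∀ k, Integrable (fun ω => -Real.log (p (X k ω))) μ := fun k =>
    ((hid k).integrable_iff.2 hL1).neg
  have hvar : 0 < Var[L 0; μ] := variance_log_letter_prob_pos hp hnonunif hL2
  set σ := √(Var[L 0; μ]) with hσdef
  have hσ : 0 < σ := Real.sqrt_pos.2 hvar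
  have hσ2 : σ ^ 2 = Var[L 0; μ] := Real.sq_sqrt hvar.le
  set H := shannonEntropy p with hH
  have hEL : ∫ ω, L 0 ω ∂μ = -H := by
    rw [hLdef, integral_comp_letter hX hp 0 (f := fun i => Real.log (p i)) hL1, hH, shannonEntropy,
      neg_neg]
  -- The standardised summands: `-log p(X_k)` has mean `H` and variance `σ²`.
  set ξ : ℕ → Ω → ℝ := fun k ω => (-L k ω - H) / σ with hξ
  have hξq : MemLp (ξ 0) (ENNReal.ofReal (2 + δ)) μ := by
    have := ((hLq.neg.sub (memLp_const H)).const_mul σ⁻¹)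
    refine (memLp_congr_ae (ae_of_all _ fun ω => ?_)).1 this
    simp only [hξ, Pi.sub_apply, Pi.neg_apply]
    ring
  have hξi : Integrable (fun ω => |ξ 0 ω| ^ (2 + δ)) μ := by
    have := (integrable_norm_rpow_iff hξq.aestronglyMeasurable hq0 ENNReal.ofReal_ne_top).2 hξq
    rwa [hqr] at this
  have hξ1 : ∫ ω, ξ 0 ω ∂μ = 0 := by
    have hneg : Integrable (fun ω => -L 0 ω) μ := hL1.neg
    simp only [hξ]
    rw [integral_div, integral_sub hneg (integrable_const _), integral_neg, hEL]
    simp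
  have hξ2 : ∫ ω, ξ 0 ω ^ 2 ∂μ = 1 := by
    have e : ∀ ω, ξ 0 ω ^ 2 = (L 0 ω - ∫ ω, L 0 ω ∂μ) ^ 2 / σ ^ 2 := fun ω => by
      simp only [hξ]; rw [hEL]; ring
    simp_rw [e]
    rw [integral_div, ← variance_eq_integral (hLm 0).aemeasurable, hσ2, div_self hvar.ne']
  obtain ⟨C₁, hC₁⟩ := exists_abs_measureReal_inv_sqrt_mul_sum_sub_cdf_le (μ := μ) (ξ := ξ)
    (hindep.comp (fun _ i => (-Real.log (p i) - H) / σ) fun _ => hmeas _)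
    (fun k => measurable_comp_letter hX k fun i => (-Real.log (p i) - H) / σ)
    (fun k => (identDistrib_letters hX hp k).comp (hmeas fun i => (-Real.log (p i) - H) / σ))
    hδ0 hδ.le hξi (hξq.mono_exponent h2q) hξ1 hξ2
  set S := ∑' i, p i ^ (1 - ε) with hS
  have hS0 : 0 ≤ S := tsum_nonneg fun i => Real.rpow_nonneg (letter_prob_nonneg hp i) _
  -- Collects the coefficients of the three mean errors: `1` from `K(n)/n`, `|C₀|` from the entropy
  -- tail, `S` from the number of observed letters.
  set D := (1 + |C₀| + S) / σ with hD
  have hD0 : 0 ≤ D := by positivity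
  refine ⟨|C₁| + (D + 1), fun n hn x => ?_⟩
  have hn0 : (0 : ℝ) < n := by positivity
  have hn1 : 1 ≤ n := by omega
  set a := (n : ℝ) ^ (-δ / 2) with ha
  set b := (n : ℝ) ^ (1 / 4 - ε / 2) with hb
  have ha0 : 0 < a := by positivity
  have hb0 : 0 < b := by positivity
  have hsn : 0 < √(n : ℝ) := Real.sqrt_pos.2 hn0
  obtain ⟨U, hUi, hU, hUE⟩ := exists_abs_jackknifeEntropy_sub_le hX hindep hp hlog
    (s := 1 - ε) (by linarith) (by linarith) hsum (K n) hn
  have hsqrt : √(n : ℝ) = (n : ℝ) ^ (1 / 2 : ℝ) := Real.sqrt_eq_rpow _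
  have ha2 : a ^ 2 = (n : ℝ) ^ (-δ) := by
    rw [ha, ← Real.rpow_natCast, ← Real.rpow_mul hn0.le]; congr 1; push_cast; ring
  have hb2 : b ^ 2 = (n : ℝ) ^ (1 / 2 - ε) := by
    rw [hb, ← Real.rpow_natCast, ← Real.rpow_mul hn0.le]; congr 1; push_cast; ring
  have hbd1 : √(n : ℝ) * (max (K n : ℝ) 0 / n) ≤ a ^ 2 := by
    have : max (K n : ℝ) 0 ≤ (n : ℝ) ^ (1 / 2 - δ) := max_le (hK n hn1) (by positivity)
    calc _ ≤ √(n : ℝ) * ((n : ℝ) ^ (1 / 2 - δ) / n) := by gcongr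
      _ = a ^ 2 := by
        rw [ha2, hsqrt, mul_div_assoc', ← Real.rpow_add hn0, ← Real.rpow_sub_one hn0.ne']
        congr 1; ring
  have hbd2 : √(n : ℝ) * -tailSum (K n) (fun i => p i * Real.log (p i)) ≤ |C₀| * a ^ 2 := by
    have h := (hK2 n hn1).trans (le_abs_self C₀)
    have e : √(n : ℝ) = a ^ 2 * (n : ℝ) ^ (1 / 2 + δ) := by
      rw [ha2, hsqrt, ← Real.rpow_add hn0]; congr 1; ring
    have h' := mul_le_mul_of_nonneg_left h (sq_nonneg a)
    rw [e]
    linarith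
  have hbd3 : √(n : ℝ) * ((n : ℝ) ^ (1 - ε) / n * S) = S * b ^ 2 := by
    have e : √(n : ℝ) * ((n : ℝ) ^ (1 - ε) / n) = b ^ 2 := by
      rw [hb2, hsqrt, mul_div_assoc', ← Real.rpow_add hn0, ← Real.rpow_sub_one hn0.ne']
      congr 1; ring
    rw [← e]; ring
  have hpert := abs_measureReal_le_sub_cdf_le_of_perturbation (μ := μ)
    (S := fun ω => (√(n : ℝ))⁻¹ * ∑ k ∈ Finset.range n, ξ k ω)
    (W := fun ω => √(n : ℝ) / σ * (jackknifeEntropy n (fun k => X k ω) - H))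
    -- The scaled mean error is of order `a² + b²`, and `η = a + b` has a square dominating both
    -- terms.
    (U := fun ω => √(n : ℝ) / σ * U ω) (B := C₁ * a) (D := D) (η := a + b) (hC₁ n hn)
    (by
      filter_upwards [hU] with ω hω
      have e : (√(n : ℝ))⁻¹ * ∑ k ∈ Finset.range n, ξ k ω = √(n : ℝ) / σ *
          ((1 / (n : ℝ)) * ∑ k ∈ Finset.range n, -Real.log (p (X k ω)) - H) := by
        simp only [hξ, hLdef]
        rw [← Finset.sum_div, Finset.sum_sub_distrib]
        simp only [Finset.sum_const, Finset.card_range, nsmul_eq_mul]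
        have hq : √(n : ℝ) * √(n : ℝ) = n := Real.mul_self_sqrt hn0.le
        field_simp
        rw [Real.sq_sqrt hn0.le]
      rw [e, ← mul_sub, sub_sub_sub_cancel_right, abs_mul, abs_of_pos (by positivity)]
      gcongr)
    (hUi.const_mul _) (by positivity)
    (by
      rw [integral_const_mul, div_mul_eq_mul_div, hD, div_mul_eq_mul_div]
      refine div_le_div_of_nonneg_right ?_ hσ.le
      have h1 := mul_le_mul_of_nonneg_left hUE hsn.le
      have h2 : √(n : ℝ) * ∫ ω, U ω ∂μ ≤ a ^ 2 + |C₀| * a ^ 2 + S * b ^ 2 := by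
        linarith
      refine h2.trans ?_
      have ha' : a ^ 2 ≤ (a + b) ^ 2 := by gcongr; linarith
      have hb' : b ^ 2 ≤ (a + b) ^ 2 := by gcongr; linarith
      have hc0 := abs_nonneg C₀
      calc a ^ 2 + |C₀| * a ^ 2 + S * b ^ 2
          ≤ (a + b) ^ 2 + |C₀| * (a + b) ^ 2 + S * (a + b) ^ 2 := by gcongr
        _ = (1 + |C₀| + S) * (a + b) ^ 2 := by ring) x
  refine hpert.trans ?_
  have hC : C₁ * a ≤ |C₁| * a := by gcongr; exact le_abs_self _
  have : 0 ≤ |C₁| * b := by positivity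
  linarith
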